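/- Let $G$ be a compact group with a (continuous) unitary representation $U$ on a finite-dimensional Hilbert space $\mathcal H\cong\bigoplus_{\lambda\in\mathrm{Irreps}_G}\mathcal Q_\lambda\otimes\mathcal M_\lambda$ (isotypic decomposition), where $\mathrm{Irreps}_G$ is the set of inequivalent irreps that appear in $U$, $\mathcal M_\lambda$ is the multiplicity space of $\lambda$, $m_\lambda=\dim\mathcal M_\lambda$, and $\Pi_\lambda$ is the orthogonal projector onto $\mathcal Q_\lambda\otimes\mathcal M_\lambda$. Let $\mathcal V^G$ be the group of unitaries on $\mathcal H$ commuting with $U(g)$ for all $g\in G$, and $\mathcal{SV}^G=[\mathcal V^G,\mathcal V^G]$ its commutator subgroup. Let $\{H_l\}_l$ be a family of $G$-invariant Hermitian operators, and suppose that the group $\mathcal W^G$ generated by the one-parameter groups $\{\exp(\mathrm i sH_l):s\in\mathbb R\}_l$ is compact and semi-universal, i.e. $\mathcal{SV}^G\subseteq\mathcal W^G\subseteq\mathcal V^G$. Let $\nu$ and $\mu_{\mathrm{Haar}}$ be the normalized Haar measures of $\mathcal W^G$ and $\mathcal V^G$, and let $t_{\max}\in\mathbb N\cup\{\infty\}$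 be the largest integer $t\ge 0$ such that $$\mathbb E_{V\sim\nu}[V^{\otimes t}\otimes (V^{*})^{\otimes t}]=\mathbb E_{V\sim\mu_{\mathrm{Haar}}}[V^{\otimes t}\otimes (V^{*})^{\otimes t}],$$ where $V^*$ is the complex conjugate of $V$ in a fixed orthonormal basis, with $t_{\max}=\infty$ if this holds for all $t$. Then for every $\Delta\subseteq\mathrm{Irreps}_G$ the following two conditions are equivalent: $$\dim\mathrm{span}_{\mathbb R}\Big\{\sum_{\mu\in\Delta}\mathrm{Tr}(H_l\Pi_\mu)\,|\mu\rangle\Big\}_l=|\Delta| \qquad\text{and}\qquad \mathrm{rk}\,\mathbf M^\Delta=|\Delta|,$$ where $\{|\mu\rangle\}_{\mu\in\Delta}$ is the standard basis of $\mathbb R^{\Delta}$ and $\mathbf M^\Delta=\big(m_\mu\,\mathrm{Tr}(\Pi_\mu H_l)/\mathrm{Tr}(\Pi_\mu)\big)_{l,\ \mu\in\Delta}$; and if they hold, then $$t_{\max}\ \ge\ \min\{\dim\mathcal M_\lambda:\lambda\in\mathrm{Irreps}_G\setminus\Delta\}-1,$$ where the minimum of the empty set is $\infty$ (so $t_{\max}=\infty$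 if $\Delta=\mathrm{Irreps}_G$). -/

import Mathlib

open MeasureTheory
open scoped Kronecker

noncomputable section

namespace SymDesign

/-- The unitary group `U(ℋ)`, with the operator-norm topology and its Borel sets. -/
abbrev UGroup (ℋ : Type*) [NormedAddCommGroup ℋ] [InnerProductSpace ℂ ℋ] [CompleteSpace ℋ] :
    Type _ :=
  ↥(unitary (ℋ →L[ℂ] ℋ))

section

variable {ℋ : Type*} [NormedAddCommGroup ℋ] [InnerProductSpace ℂ ℋ] [CompleteSpace ℋ]
  {G : Type*} [Group G]

/-! ### The isotypic decomposition -/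

/-- The linear representation underlying a unitary representation `U`. -/
def rep (U : G →* UGroup ℋ) : Representation ℂ G ℋ where
  toFun g := ((U g : ℋ →L[ℂ] ℋ) : ℋ →ₗ[ℂ] ℋ)
  map_one' := by ext; simp
  map_mul' g h := by ext; simp

/-- The irreducible subrepresentations of `U`. -/
abbrev IrredSub (U : G →* UGroup ℋ) : Type _ :=
  {σ : Subrepresentation (rep U) // σ.toRepresentation.IsIrreducible}

/-- Isomorphism (equivalence) of irreducible subrepresentations. -/
instance irredSetoid (U : G →* UGroup ℋ) : Setoid (IrredSub U) where
  r σ τ := Nonempty (σ.1.toRepresentation.Equiv τ.1.toRepresentation)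
  iseqv :=
    { refl := fun _ => ⟨Representation.Equiv.refl _⟩
      symm := fun ⟨e⟩ => ⟨e.symm⟩
      trans := fun ⟨e⟩ ⟨f⟩ => ⟨e.trans f⟩ }

/-- `Irreps_G`: the inequivalent irreducible representations of `G` that appear in `U`. -/
def Irreps (U : G →* UGroup ℋ) : Type _ := Quotient (irredSetoid U)

/-- The sector `𝒬_μ ⊗ ℳ_μ` of `ℋ`: the sum of all invariant subspaces carrying the irrep `μ`. -/
def sector (U : G →* UGroup ℋ) (μ : Irreps U) : Submodule ℂ ℋ :=
  ⨆ σ : {σ : IrredSub U // (Quotient.mk (irredSetoid U) σ : Irreps U) = μ}, σ.1.1.toSubmodule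

/-- A representative `𝒬_μ` of the irrep `μ`. -/
def irrepRepr (U : G →* UGroup ℋ) (μ : Irreps U) : IrredSub U := Quotient.out μ

/-- The multiplicity space `ℳ_μ = Hom_G(𝒬_μ, ℋ)`. -/
abbrev MultSpace (U : G →* UGroup ℋ) (μ : Irreps U) : Type _ :=
  Representation.IntertwiningMap (irrepRepr U μ).1.toRepresentation (rep U)

/-- The multiplicity `m_μ = dim ℳ_μ`. -/
def mult (U : G →* UGroup ℋ) (μ : Irreps U) : ℕ := Module.finrank ℂ (MultSpace U μ)

/-- The trace of an operator on `ℋ`. -/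
def tr (A : ℋ →L[ℂ] ℋ) : ℂ := LinearMap.trace ℂ ℋ (A : ℋ →ₗ[ℂ] ℋ)

/-! ### Symmetric unitaries -/

/-- `𝒱^G`: the group of unitaries commuting with `U g` for all `g`. -/
def symUnitaries (U : G →* UGroup ℋ) : Subgroup (UGroup ℋ) := Subgroup.centralizer (Set.range U)

/-- `𝒮𝒱^G = [𝒱^G, 𝒱^G]`: the commutator subgroup, as a subgroup of `U(ℋ)`. -/
def specialSymUnitaries (U : G →* UGroup ℋ) : Subgroup (UGroup ℋ) :=
  ⁅symUnitaries U, symUnitaries U⁆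

/-- `𝒮𝒱^G ⊆ 𝒲 ⊆ 𝒱^G`. -/
def IsSemiUniversal (U : G →* UGroup ℋ) (W : Subgroup (UGroup ℋ)) : Prop :=
  specialSymUnitaries U ≤ W ∧ W ≤ symUnitaries U

/-- `A` is a `G`-invariant Hermitian operator. -/
def IsInvariantHamiltonian (U : G →* UGroup ℋ) (A : ℋ →L[ℂ] ℋ) : Prop :=
  IsSelfAdjoint A ∧ ∀ g, Commute A (U g : ℋ →L[ℂ] ℋ)

/-- The group generated by the one-parameter groups `{exp(i s H_l) : s ∈ ℝ}`. -/
def generatedGroup {ι : Type*} (H : ι → ℋ →L[ℂ] ℋ) : Subgroup (UGroup ℋ) :=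
  Subgroup.closure {V : UGroup ℋ | ∃ (l : ι) (s : ℝ),
    (V : ℋ →L[ℂ] ℋ) = NormedSpace.exp ((Complex.I * (s : ℂ)) • H l)}

variable [FiniteDimensional ℂ ℋ]

instance compactSpace_UGroup : CompactSpace (UGroup ℋ) := by
  have : ProperSpace (ℋ →L[ℂ] ℋ) := FiniteDimensional.proper ℂ _
  have key : IsCompact (unitary (ℋ →L[ℂ] ℋ) : Set (ℋ →L[ℂ] ℋ)) := ?_
  · exact isCompact_iff_compactSpace.mp key
  refine Metric.isCompact_of_isClosed_isBounded isClosed_unitary ?_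
  refine isBounded_iff_forall_norm_le.mpr ⟨1, fun A hA => ?_⟩
  refine ContinuousLinearMap.opNorm_le_bound _ zero_le_one fun x => ?_
  have := ContinuousLinearMap.norm_map_of_mem_unitary hA x
  simp [this]

instance compactSpace_symUnitaries (U : G →* UGroup ℋ) : CompactSpace (symUnitaries U) :=
  isCompact_iff_compactSpace.mp
    (Set.isClosed_centralizer (Set.range U)).isCompact

/-! ### Relative phases -/

/-- `Π_μ`: the orthogonal projector onto the sector of `μ`. -/
def proj (U : G →* UGroup ℋ) (μ : Irreps U) : ℋ →L[ℂ] ℋ := (sector U μ).starProjection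

/-- The vector `∑_{μ ∈ Δ} Tr(A Π_μ) |μ⟩` describing the projection of a Hermitian `A` onto
`span {Π_μ : μ ∈ Δ}`.  These traces are real, as `A` and `Π_μ` are Hermitian. -/
def chiVec (U : G →* UGroup ℋ) (Δ : Finset (Irreps U)) (A : ℋ →L[ℂ] ℋ) : Δ → ℝ :=
  fun μ => (tr (A * proj U μ.1)).re

/-- The projections of the `H_l` onto `span {Π_μ : μ ∈ Δ}` span a `|Δ|`-dimensional space. -/
def PhasesFree {ι : Type*} (U : G →* UGroup ℋ) (H : ι → ℋ →L[ℂ] ℋ)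
    (Δ : Finset (Irreps U)) : Prop :=
  Module.finrank ℝ (Submodule.span ℝ (Set.range fun l => chiVec U Δ (H l))) = Δ.card

/-- The matrix `M^Δ`, with entries `m_μ Tr(Π_μ H_l) / Tr(Π_μ)`. -/
def phaseMatrix {ι : Type*} (U : G →* UGroup ℋ) (H : ι → ℋ →L[ℂ] ℋ)
    (Δ : Finset (Irreps U)) : Matrix ι Δ ℝ :=
  Matrix.of fun l μ => mult U μ.1 * (tr (proj U μ.1 * H l)).re / (tr (proj U μ.1)).re

/-! ### Unitary designs -/

/-- The uniform (normalized Haar) measure of a compact subgroup `K`, as a measure on `U(ℋ)`. -/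
def uniformMeasure (K : Subgroup (UGroup ℋ)) [CompactSpace K] : Measure (UGroup ℋ) :=
  (Measure.haarMeasure (⊤ : TopologicalSpace.PositiveCompacts K)).map Subtype.val

end

/-- The matrix of the `t`-th tensor power `A^{⊗t}`. -/
def tensorPow {κ : Type*} (t : ℕ) (A : Matrix κ κ ℂ) : Matrix (Fin t → κ) (Fin t → κ) ℂ :=
  Matrix.of fun i j => ∏ a, A (i a) (j a)

section

variable {ℋ : Type*} [NormedAddCommGroup ℋ] [InnerProductSpace ℂ ℋ] [CompleteSpace ℋ]
  [FiniteDimensional ℂ ℋ] {κ : Type*} [Fintype κ] [DecidableEq κ]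
  {G : Type*} [Group G]

/-- The matrix of a unitary with respect to an orthonormal basis. -/
def matrixOf (b : OrthonormalBasis κ ℂ ℋ) (V : UGroup ℋ) : Matrix κ κ ℂ :=
  LinearMap.toMatrix b.toBasis b.toBasis ((V : ℋ →L[ℂ] ℋ) : ℋ →ₗ[ℂ] ℋ)

/-- The `t`-th moment `𝔼_{V ∼ ν} [V^{⊗t} ⊗ (V^*)^{⊗t}]` (an entrywise integral), where `V^*` is the
complex conjugate of `V` with respect to the orthonormal basis `b`. -/
def moment (b : OrthonormalBasis κ ℂ ℋ) (ν : Measure (UGroup ℋ)) (t : ℕ) :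
    Matrix ((Fin t → κ) × (Fin t → κ)) ((Fin t → κ) × (Fin t → κ)) ℂ :=
  Matrix.of fun i j =>
    ∫ V, (tensorPow t (matrixOf b V) ⊗ₖ tensorPow t ((matrixOf b V).map star)) i j ∂ν

/-- `ν` is a `t`-design for the uniform distribution over `𝒱^G`. -/
def IsDesign (b : OrthonormalBasis κ ℂ ℋ) (U : G →* UGroup ℋ) (ν : Measure (UGroup ℋ))
    (t : ℕ) : Prop :=
  moment b ν t = moment b (uniformMeasure (symUnitaries U)) t

/-- `t_max` of the uniform distribution over `W`: the largest `t` for which it is a `t`-design for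
the uniform distribution over `𝒱^G`, and `∞` if there is no largest one. -/
def tMax (b : OrthonormalBasis κ ℂ ℋ) (U : G →* UGroup ℋ) (W : Subgroup (UGroup ℋ))
    [CompactSpace W] : ℕ∞ :=
  sSup ((fun t : ℕ => (t : ℕ∞)) '' {t | IsDesign b U (uniformMeasure W) t})

end

end SymDesign

end

/-!
For every compact group `K` of unitaries, the `t`-th moment `M_K` of its uniform measure is the
average of `ρ(V) = V^{⊗t} ⊗ (V^*)^{⊗t}` over `K`, so `ρ(V) M_K = M_K = M_K ρ(V)` for `V ∈ K`. As
`𝒲 ≤ 𝒱^G`, the two moments agree as soon as `ρ(V) M_𝒲 = M_𝒲` for all `V ∈ 𝒱^G`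
(`moment_eq_of_forall`).

Every `V ∈ 𝒱^G` is the product of an element of the central torus `{∑_μ w_μ Π_μ : |w_μ| = 1}` and of
an element of `𝒮𝒱^G ≤ 𝒲` (`exists_eq_central_mul`), so only the central torus has to be shown to fix
`M_𝒲`. The projectors `Π_μ` decompose the mixed tensor power into components on which the central
torus acts through the characters `∏_μ w_μ ^ {k_μ}`, with `|k_μ| ≤ t`. Suppose that the weight `k`
occurs in `M_𝒲`; then the character is trivial on the central elements of `𝒲`
(`IsResolution.prod_zpow_weight_eq_one`).

* Acting on the sector of `μ` by an `m_μ`-th root of unity is an element of `𝒮𝒱^G`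
  (`exists_central_rootOfUnity_mem`), so `m_μ` divides `k_μ`. For `μ ∉ Δ` one has `|k_μ| ≤ t < m_μ`,
  hence `k_μ = 0`.
* Up to `𝒮𝒱^G`, `exp(i s H_l)` is the central element with phases `s Tr(H_l Π_μ) / Tr Π_μ`
  (`exists_exp_eq_central_mul`), so `∑_{μ ∈ Δ} k_μ Tr(H_l Π_μ) / Tr Π_μ = 0` for all `l`. As the
  vectors `(Tr(H_l Π_μ))_{μ ∈ Δ}` span `ℝ^Δ`, `k` vanishes on `Δ` too.

Hence only the trivial weight occurs, and the central torus fixes `M_𝒲`.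

The facts about `𝒮𝒱^G` come from diagonalization: a normal operator of the commutant is scalar on
each term of an orthogonal decomposition of `ℋ` into irreducible subspaces
(`exists_irred_decomposition`). For two equivalent irreducible summands, the commutator of a phase
on the first one with a unitary of `𝒱^G` swapping them is that phase on the first and its inverse on
the second. So every diagonal unitary whose phases multiply to `1` over each isotypic class lies in
`𝒮𝒱^G` (`IsResolution.diagHom_mem_specialSymUnitaries`).

The two rank conditions are equivalent since the columns of `M^Δ` are the nonzero multiples
`m_μ / Tr Π_μ` of the columns `Tr(H_l Π_μ)`.
-/

namespace SymDesign

/-! ### Invariant subspaces and irreducible projections -/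

section

variable {ℋ : Type*} [NormedAddCommGroup ℋ] [InnerProductSpace ℂ ℋ] [CompleteSpace ℋ]
  {G : Type*} [Group G] (U : G →* UGroup ℋ)

/-- The commutant of the representation: the operators commuting with every `U g`. -/
def commutant : Subalgebra ℂ (ℋ →L[ℂ] ℋ) :=
  Subalgebra.centralizer ℂ (Set.range fun g => (U g : ℋ →L[ℂ] ℋ))

variable {U}

lemma star_apply_group (g : G) : star (U g : ℋ →L[ℂ] ℋ) = (U g⁻¹ : ℋ →L[ℂ] ℋ) := by
  rw [map_inv]; rfl

lemma mem_commutant {A : ℋ →L[ℂ] ℋ} :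
    A ∈ commutant U ↔ ∀ g, Commute A (U g : ℋ →L[ℂ] ℋ) := by
  simp only [commutant, Subalgebra.mem_centralizer_iff, Set.mem_range, forall_exists_index,
    forall_apply_eq_imp_iff]
  exact forall_congr' fun g => eq_comm

lemma star_mem_commutant {A : ℋ →L[ℂ] ℋ} (hA : A ∈ commutant U) : star A ∈ commutant U := by
  rw [mem_commutant] at *
  intro g
  have h := (hA g⁻¹).star_star
  rwa [star_apply_group, inv_inv] at h

lemma commutant_apply {A : ℋ →L[ℂ] ℋ} (hA : A ∈ commutant U) (g : G) (x : ℋ) :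
    A (rep U g x) = rep U g (A x) :=
  congrArg (fun B : ℋ →L[ℂ] ℋ => B x) (mem_commutant.mp hA g)

lemma coe_mem_commutant {V : UGroup ℋ} :
    (V : ℋ →L[ℂ] ℋ) ∈ commutant U ↔ V ∈ symUnitaries U := by
  rw [mem_commutant, symUnitaries, Subgroup.mem_centralizer_iff]
  simp only [Set.mem_range, forall_exists_index, forall_apply_eq_imp_iff]
  refine forall_congr' fun g => ?_
  rw [Subtype.ext_iff]
  exact eq_comm

/-- The class in `Irreps_G` of an irreducible invariant subspace. -/
def irredClass (σ : IrredSub U) : Irreps U := Quotient.mk (irredSetoid U) σ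

lemma irredClass_eq_iff {σ τ : IrredSub U} : irredClass σ = irredClass τ ↔
    Nonempty (σ.1.toRepresentation.Equiv τ.1.toRepresentation) :=
  Quotient.eq (r := irredSetoid U)

lemma irred_ne_bot (σ : IrredSub U) : σ.1.toSubmodule ≠ ⊥ := by
  have := σ.2
  obtain ⟨a, b, hab⟩ := this.toNontrivial
  intro h
  have hs : Subsingleton σ.1.toSubmodule := by rw [h]; infer_instance
  refine hab (Subrepresentation.ext ?_)
  exact Subsingleton.elim _ _

variable [FiniteDimensional ℂ ℋ]

/-- The orthogonal projection onto an irreducible invariant subspace. -/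
noncomputable def irredProj (σ : IrredSub U) : ℋ →L[ℂ] ℋ := σ.1.toSubmodule.starProjection

lemma starProjection_mem_commutant (N : Submodule ℂ ℋ) (hN : ∀ g, ∀ x ∈ N, rep U g x ∈ N) :
    N.starProjection ∈ commutant U := by
  set P := N.starProjection with hP
  have hsa : star P = P := isSelfAdjoint_starProjection N
  have key : ∀ g, P * (U g : ℋ →L[ℂ] ℋ) * P = (U g : ℋ →L[ℂ] ℋ) * P := fun g => by
    ext x
    exact Submodule.starProjection_eq_self_iff.mpr (hN g _ (N.starProjection_apply_mem x))
  rw [mem_commutant]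
  intro g
  have h := congrArg star (key g⁻¹)
  rw [star_mul, star_mul, star_mul, hsa, star_apply_group, inv_inv, ← mul_assoc, key] at h
  exact h.symm

lemma irredProj_mem_commutant (σ : IrredSub U) : irredProj σ ∈ commutant U :=
  starProjection_mem_commutant _ fun g _ hx => σ.1.apply_mem_toSubmodule g hx

lemma irredProj_isSelfAdjoint (σ : IrredSub U) : IsSelfAdjoint (irredProj σ) :=
  isSelfAdjoint_starProjection _

lemma irredProj_mul_self (σ : IrredSub U) : irredProj σ * irredProj σ = irredProj σ :=
  Submodule.isIdempotentElem_starProjection _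

lemma irredProj_apply_mem (σ : IrredSub U) (x : ℋ) : irredProj σ x ∈ σ.1.toSubmodule :=
  Submodule.starProjection_apply_mem _ x

lemma irredProj_apply_of_mem (σ : IrredSub U) {x : ℋ} (hx : x ∈ σ.1.toSubmodule) :
    irredProj σ x = x :=
  Submodule.starProjection_eq_self_iff.mpr hx

lemma irredProj_ne_zero (σ : IrredSub U) : irredProj σ ≠ 0 := by
  obtain ⟨x, hx, hx0⟩ := Submodule.exists_mem_ne_zero_of_ne_bot (irred_ne_bot σ)
  intro h
  have := irredProj_apply_of_mem σ hx
  rw [h] at this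
  exact hx0 this.symm

/-! ### Schur's lemma for operators in the commutant -/

/-- The map between irreducible subspaces obtained by compressing an operator of the commutant. -/
noncomputable def compress {A : ℋ →L[ℂ] ℋ} (hA : A ∈ commutant U) (σ τ : IrredSub U) :
    Representation.IntertwiningMap σ.1.toRepresentation τ.1.toRepresentation where
  toLinearMap := (((irredProj τ * A : ℋ →L[ℂ] ℋ) : ℋ →ₗ[ℂ] ℋ).codRestrict τ.1.toSubmodule
    fun x => irredProj_apply_mem τ (A x)) ∘ₗ σ.1.toSubmodule.subtype
  isIntertwining' g := by
    ext x
    exact commutant_apply (mul_mem (irredProj_mem_commutant τ) hA) g x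

lemma exists_smul_of_mem_commutant {A : ℋ →L[ℂ] ℋ} (hA : A ∈ commutant U) (σ : IrredSub U) :
    ∃ c : ℂ, irredProj σ * A * irredProj σ = c • irredProj σ := by
  have := σ.2
  obtain ⟨c, hc⟩ := (Representation.IsIrreducible.algebraMap_intertwiningMap_bijective_of_isAlgClosed
    (ρ := σ.1.toRepresentation)).2 (compress hA σ σ)
  refine ⟨c, ?_⟩
  ext x
  have h := congrArg (fun f => ((f ⟨_, irredProj_apply_mem σ x⟩ : σ.1.toSubmodule) : ℋ)) hc
  exact h.symm

lemma irredProj_mul_mul_eq_zero {A : ℋ →L[ℂ] ℋ} (hA : A ∈ commutant U) {σ τ : IrredSub U}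
    (h : irredClass σ ≠ irredClass τ) : irredProj τ * A * irredProj σ = 0 := by
  have := σ.2
  have := τ.2
  rcases Representation.IsIrreducible.bijective_or_eq_zero (compress hA σ τ) with hb | h0
  · exact absurd (irredClass_eq_iff.mpr ⟨Representation.IntertwiningMap.ofBijective _ hb⟩) h
  · ext x
    exact congrArg (fun f => ((f ⟨_, irredProj_apply_mem σ x⟩ : τ.1.toSubmodule) : ℋ)) h0

/-- An isomorphism of irreducible subspaces can be chosen unitary, which gives a partial isometry
of the commutant. -/
lemma exists_partialIsometry {σ τ : IrredSub U} (h : irredClass σ = irredClass τ) :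
    ∃ B ∈ commutant U, star B * B = irredProj σ ∧ B * star B = irredProj τ := by
  obtain ⟨φ⟩ := irredClass_eq_iff.mp h
  set P := irredProj σ with hP
  set Q := irredProj τ with hQ
  let B : ℋ →L[ℂ] ℋ := LinearMap.toContinuousLinearMap
    (τ.1.toSubmodule.subtype ∘ₗ φ.toLinearMap ∘ₗ
      ((P : ℋ →ₗ[ℂ] ℋ).codRestrict σ.1.toSubmodule fun x => irredProj_apply_mem σ x))
  have hBx : ∀ x, B x = (φ ⟨P x, irredProj_apply_mem σ x⟩ : ℋ) := fun x => rfl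
  have hB : B ∈ commutant U := by
    rw [mem_commutant]
    intro g
    ext x
    have h1 : (⟨P (rep U g x), irredProj_apply_mem σ _⟩ : σ.1.toSubmodule)
        = σ.1.toRepresentation g ⟨P x, irredProj_apply_mem σ x⟩ :=
      Subtype.ext (commutant_apply (irredProj_mem_commutant σ) g x)
    have h2 : B (rep U g x) = rep U g (B x) := by
      rw [hBx, hBx, h1]
      exact congrArg Subtype.val (Representation.IntertwiningMap.isIntertwining _ _ φ.toIntertwiningMap g _)
    exact h2
  have hPP : P * P = P := irredProj_mul_self σ
  have hBP : B * P = B := by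
    ext x
    have : P (P x) = P x := congrArg (fun A : ℋ →L[ℂ] ℋ => A x) hPP
    change B (P x) = B x
    simp only [hBx, this]
  have hQB : Q * B = B := by
    ext x
    exact irredProj_apply_of_mem τ (φ _).2
  have hP' : star P = P := irredProj_isSelfAdjoint σ
  have hQ' : star Q = Q := irredProj_isSelfAdjoint τ
  -- by Schur's lemma, `B* B = c P` and `B B* = d Q`; then `c = d > 0`, and `B / √c` is a partial
  -- isometry
  obtain ⟨c, hc⟩ := exists_smul_of_mem_commutant (mul_mem (star_mem_commutant hB) hB) σ
  obtain ⟨d, hd⟩ := exists_smul_of_mem_commutant (mul_mem hB (star_mem_commutant hB)) τ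
  have hPB : P * star B = star B := by rw [← hP', ← star_mul, hBP]
  have hBQ : star B * Q = star B := by rw [← hQ', ← star_mul, hQB]
  rw [← hP, ← mul_assoc, hPB, mul_assoc, hBP] at hc
  rw [← hQ, ← mul_assoc, hQB, mul_assoc, hBQ] at hd
  obtain ⟨x, hx, hx0⟩ := Submodule.exists_mem_ne_zero_of_ne_bot (irred_ne_bot σ)
  have hPx : P x = x := irredProj_apply_of_mem σ hx
  have hBx0 : B x ≠ 0 := by
    intro h0
    rw [hBx] at h0
    have h1 := (LinearEquiv.map_eq_zero_iff φ.toLinearEquiv).mp (Subtype.ext h0)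
    exact hx0 (hPx ▸ congrArg Subtype.val h1)
  have hcd : c = d := by
    have h1 : B * (star B * B) = (B * star B) * B := (mul_assoc _ _ _).symm
    rw [hc, hd, mul_smul_comm, smul_mul_assoc, hBP, hQB] at h1
    have h2 : c • B x = d • B x := congrArg (fun A : ℋ →L[ℂ] ℋ => A x) h1
    exact smul_left_injective ℂ hBx0 h2
  have hnorm : ((‖B x‖ ^ 2 : ℝ) : ℂ) = c * ((‖x‖ ^ 2 : ℝ) : ℂ) := by
    have h1 : inner ℂ x ((star B * B) x) = c * inner ℂ x x := by
      rw [hc, smul_apply, hPx, inner_smul_right]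
    have h2 : inner ℂ x ((star B * B) x) = inner ℂ (B x) (B x) :=
      ContinuousLinearMap.adjoint_inner_right B x (B x)
    rw [h2, inner_self_eq_norm_sq_to_K, inner_self_eq_norm_sq_to_K] at h1
    push_cast
    exact h1
  have hxpos : 0 < ‖x‖ ^ 2 := by positivity
  have hBpos : 0 < ‖B x‖ ^ 2 := by positivity
  set r : ℝ := ‖B x‖ ^ 2 / ‖x‖ ^ 2 with hr
  have hrpos : 0 < r := by positivity
  have hcr : c = (r : ℂ) := by
    rw [hr]
    push_cast at hnorm ⊢
    rw [hnorm, mul_div_cancel_right₀]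
    exact_mod_cast hxpos.ne'
  set s : ℂ := (((Real.sqrt r)⁻¹ : ℝ) : ℂ) with hs
  have hss : star s * s * c = 1 := by
    rw [hs, hcr, Complex.star_def, Complex.conj_ofReal]
    have : (Real.sqrt r)⁻¹ * (Real.sqrt r)⁻¹ * r = 1 := by
      rw [← mul_inv, Real.mul_self_sqrt hrpos.le, inv_mul_cancel₀ hrpos.ne']
    exact_mod_cast this
  refine ⟨s • B, Subalgebra.smul_mem _ hB s, ?_, ?_⟩
  · rw [star_smul, smul_mul_smul_comm, hc, smul_smul, hss, one_smul]
  · rw [star_smul, smul_mul_smul_comm, hd, smul_smul, ← hcd, mul_comm s, hss, one_smul]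

end

/-! ### Orthogonal resolutions of the identity -/

section

variable {ℋ : Type*} [NormedAddCommGroup ℋ] [InnerProductSpace ℂ ℋ] [CompleteSpace ℋ]
  {J : Type*} [Fintype J]

/-- A resolution of the identity into pairwise orthogonal projections. -/
structure IsResolution (p : J → ℋ →L[ℂ] ℋ) : Prop extends CompleteOrthogonalIdempotents p where
  isSelfAdjoint : ∀ j, IsSelfAdjoint (p j)

/-- The operator acting as the scalar `z j` on the range of `p j`. -/
def diagOp (p : J → ℋ →L[ℂ] ℋ) (z : J → ℂ) : ℋ →L[ℂ] ℋ := ∑ j, z j • p j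

namespace IsResolution

variable {p : J → ℋ →L[ℂ] ℋ} (hp : IsResolution p)
include hp

lemma diagOp_mul_proj (z : J → ℂ) (j : J) : diagOp p z * p j = z j • p j := by
  classical
  simp only [diagOp, Finset.sum_mul, smul_mul_assoc, hp.toOrthogonalIdempotents.mul_eq, smul_ite,
    smul_zero]
  simp

lemma proj_mul_diagOp (z : J → ℂ) (j : J) : p j * diagOp p z = z j • p j := by
  classical
  simp only [diagOp, Finset.mul_sum, mul_smul_comm, hp.toOrthogonalIdempotents.mul_eq, smul_ite,
    smul_zero]
  simp

lemma diagOp_mul (z w : J → ℂ) : diagOp p z * diagOp p w = diagOp p (z * w) := by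
  conv_lhs => rw [diagOp.eq_1 p w]
  simp only [Finset.mul_sum, mul_smul_comm, hp.diagOp_mul_proj, smul_smul]
  exact Finset.sum_congr rfl fun j _ => by rw [Pi.mul_apply, mul_comm]

lemma diagOp_one : diagOp p 1 = 1 := by
  simp [diagOp, hp.complete]

lemma star_diagOp (z : J → ℂ) : star (diagOp p z) = diagOp p (star z) := by
  simp only [diagOp, star_sum, star_smul]
  exact Finset.sum_congr rfl fun j _ => by rw [(hp.isSelfAdjoint j).star_eq]; rfl

lemma exp_diagOp (z : J → ℂ) :
    NormedSpace.exp (diagOp p z) = diagOp p fun j => Complex.exp (z j) := by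
  let f : (J → ℂ) →+* (ℋ →L[ℂ] ℋ) :=
    { toFun := diagOp p
      map_one' := hp.diagOp_one
      map_mul' := fun z w => (hp.diagOp_mul z w).symm
      map_zero' := by simp [diagOp]
      map_add' := fun z w => by simp [diagOp, add_smul, Finset.sum_add_distrib] }
  have hf : Continuous (diagOp p) := by
    unfold diagOp
    fun_prop
  let _ : NormedAlgebra ℚ (J → ℂ) := NormedAlgebra.restrictScalars ℚ ℂ _
  let _ : Algebra ℚ (ℋ →L[ℂ] ℋ) := Algebra.compHom _ (algebraMap ℚ ℂ)
  have h := NormedSpace.map_exp f hf z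
  have h2 : NormedSpace.exp z = fun j => Complex.exp (z j) := by
    rw [Pi.exp_def, Complex.exp_eq_exp_ℂ]
  rw [h2] at h
  exact h.symm

/-- The diagonal unitaries of a resolution of the identity, parametrized by their phases. -/
noncomputable def diagHom : (J → Circle) →* UGroup ℋ where
  toFun z := ⟨diagOp p fun j => (z j : ℂ), by
    have h : ((fun j => (z j : ℂ)) * star fun j => (z j : ℂ)) = 1 := by
      ext j
      simp [Complex.mul_conj]
    rw [Unitary.mem_iff, hp.star_diagOp, hp.diagOp_mul, hp.diagOp_mul, mul_comm, h]
    exact ⟨hp.diagOp_one, hp.diagOp_one⟩⟩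
  map_one' := Subtype.ext hp.diagOp_one
  map_mul' z w := Subtype.ext (hp.diagOp_mul _ _).symm

lemma coe_diagHom (z : J → Circle) :
    (hp.diagHom z : ℋ →L[ℂ] ℋ) = diagOp p fun j => (z j : ℂ) := rfl

end IsResolution

end

/-! ### Decompositions into irreducible subspaces -/

section

variable {ℋ : Type*} [NormedAddCommGroup ℋ] [InnerProductSpace ℂ ℋ] [CompleteSpace ℋ]
  [FiniteDimensional ℂ ℋ] {G : Type*} [Group G] {U : G →* UGroup ℋ}

/-- In a nonzero subspace which is stable under `U`, `A` and `A*`, there is an irreducible one on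
which `A` and `A*` act as scalars: take a minimal nonzero stable subspace, which has to lie in a
single eigenspace. -/
lemma exists_irred_le {A : ℋ →L[ℂ] ℋ} (hA : A ∈ commutant U) (hn : Commute A (star A))
    {N : Submodule ℂ ℋ} (hN0 : N ≠ ⊥) (hNU : ∀ g, ∀ x ∈ N, rep U g x ∈ N)
    (hNA : ∀ x ∈ N, A x ∈ N) (hNA' : ∀ x ∈ N, star A x ∈ N) :
    ∃ σ : IrredSub U, σ.1.toSubmodule ≤ N ∧ ∃ a b : ℂ,
      (∀ x ∈ σ.1.toSubmodule, A x = a • x) ∧ ∀ x ∈ σ.1.toSubmodule, star A x = b • x := by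
  let S : Set (Submodule ℂ ℋ) := {M | M ≠ ⊥ ∧ M ≤ N ∧ (∀ g, ∀ x ∈ M, rep U g x ∈ M) ∧
    (∀ x ∈ M, A x ∈ M) ∧ ∀ x ∈ M, star A x ∈ M}
  obtain ⟨M, ⟨hM0, hMN, hMU, hMA, hMA'⟩, hmin⟩ :=
    (wellFounded_lt (α := Submodule ℂ ℋ)).has_min S ⟨N, hN0, le_rfl, hNU, hNA, hNA'⟩
  have hmin' : ∀ M' ∈ S, M' ≤ M → M' = M := fun M' h h' =>
    h'.eq_of_not_lt (hmin M' h)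
  have scalar : ∀ X : ℋ →L[ℂ] ℋ, X ∈ commutant U → Commute A X → Commute (star A) X →
      (∀ x ∈ M, X x ∈ M) → ∃ c : ℂ, ∀ x ∈ M, X x = c • x := by
    intro X hXU hXA hXA' hXM
    have : Nontrivial M := Submodule.nontrivial_iff_ne_bot.mpr hM0
    obtain ⟨c, hc⟩ := Module.End.exists_eigenvalue ((X : ℋ →ₗ[ℂ] ℋ).restrict hXM)
    obtain ⟨v, hv⟩ := hc.exists_hasEigenvector
    have hv1 : X v = c • (v : ℋ) := congrArg Subtype.val hv.apply_eq_smul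
    have hv0 : (v : ℋ) ≠ 0 := fun h => hv.2 (Subtype.ext h)
    let M' : Submodule ℂ ℋ := M ⊓ ((X : ℋ →ₗ[ℂ] ℋ) - c • LinearMap.id).ker
    have mem : ∀ x, x ∈ M' ↔ x ∈ M ∧ X x = c • x := fun x => by
      simp [M', sub_eq_zero]
    have hM' : M' = M := by
      refine hmin' M' ⟨?_, inf_le_left.trans hMN, ?_, ?_, ?_⟩ inf_le_left
      · intro h
        have : (v : ℋ) ∈ M' := (mem _).mpr ⟨v.2, hv1⟩
        rw [h] at this
        exact hv0 this
      · intro g x hx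
        rw [mem] at hx ⊢
        refine ⟨hMU g x hx.1, ?_⟩
        rw [commutant_apply hXU, hx.2, map_smul]
      · intro x hx
        rw [mem] at hx ⊢
        refine ⟨hMA x hx.1, ?_⟩
        have h : A (X x) = X (A x) := congrArg (fun B : ℋ →L[ℂ] ℋ => B x) hXA
        rw [← h, hx.2, map_smul]
      · intro x hx
        rw [mem] at hx ⊢
        refine ⟨hMA' x hx.1, ?_⟩
        have h : star A (X x) = X (star A x) := congrArg (fun B : ℋ →L[ℂ] ℋ => B x) hXA'
        rw [← h, hx.2, map_smul]
    refine ⟨c, fun x hx => ((mem x).mp ?_).2⟩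
    rwa [hM']
  obtain ⟨a, ha⟩ := scalar A hA (Commute.refl A) hn.symm hMA
  obtain ⟨b, hb⟩ := scalar (star A) (star_mem_commutant hA) hn (Commute.refl _) hMA'
  let τ : Subrepresentation (rep U) := ⟨M, fun g x hx => hMU g x hx⟩
  have hτ : τ.toRepresentation.IsIrreducible := by
    have : Nontrivial (Subrepresentation τ.toRepresentation) := by
      refine ⟨⊥, ⊤, fun h => hM0 ?_⟩
      have h1 : (⊥ : Submodule ℂ M) = ⊤ := congrArg Subrepresentation.toSubmodule h
      rw [eq_bot_iff]
      intro x hx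
      have h2 : (⟨x, hx⟩ : M) ∈ (⊥ : Submodule ℂ M) := h1 ▸ Submodule.mem_top
      exact congrArg Subtype.val ((Submodule.mem_bot ℂ).mp h2)
    refine ⟨fun F => ?_⟩
    by_cases hF : F.toSubmodule = ⊥
    · exact Or.inl (Subrepresentation.toSubmodule_injective hF)
    right
    have hle : F.toSubmodule.map M.subtype ≤ M := Submodule.map_subtype_le M _
    have hF' : F.toSubmodule.map M.subtype = M := by
      refine hmin' _ ⟨?_, hle.trans hMN, ?_, ?_, ?_⟩ hle
      · intro h
        refine hF (Submodule.map_injective_of_injective M.injective_subtype ?_)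
        rw [h, Submodule.map_bot]
      · rintro g _ ⟨x, hx, rfl⟩
        exact ⟨_, F.apply_mem_toSubmodule g hx, rfl⟩
      · intro x hx
        rw [ha x (hle hx)]
        exact Submodule.smul_mem _ _ hx
      · intro x hx
        rw [hb x (hle hx)]
        exact Submodule.smul_mem _ _ hx
    apply Subrepresentation.toSubmodule_injective
    change F.toSubmodule = ⊤
    apply Submodule.map_injective_of_injective M.injective_subtype
    rw [hF', Submodule.map_subtype_top]
  exact ⟨⟨τ, hτ⟩, hMN, a, b, ha, hb⟩

/-- The decomposition into irreducible subspaces on which `A` is scalar, for a stable subspace `N`,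
by induction on its dimension: split off one irreducible subspace and continue in its orthogonal
complement in `N`. -/
lemma exists_irred_decomposition_of_stable {A : ℋ →L[ℂ] ℋ} (hA : A ∈ commutant U)
    (hn : Commute A (star A)) (N : Submodule ℂ ℋ) (hNU : ∀ g, ∀ x ∈ N, rep U g x ∈ N)
    (hNA : ∀ x ∈ N, A x ∈ N) (hNA' : ∀ x ∈ N, star A x ∈ N) :
    ∃ (n : ℕ) (E : Fin n → IrredSub U) (a : Fin n → ℂ),
      (Pairwise fun i j => irredProj (E i) * irredProj (E j) = 0) ∧
      ∑ j, irredProj (E j) = N.starProjection ∧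
      A * N.starProjection = ∑ j, a j • irredProj (E j) := by
  induction hd : Module.finrank ℂ N using Nat.strong_induction_on generalizing N with
  | _ d ih =>
  by_cases hN0 : N = ⊥
  · subst hN0
    exact ⟨0, Fin.elim0, Fin.elim0, fun i => i.elim0, by simp, by simp⟩
  obtain ⟨σ, hσN, a, b, ha, hb⟩ := exists_irred_le hA hn hN0 hNU hNA hNA'
  have stable : ∀ X : ℋ →L[ℂ] ℋ, (∀ x ∈ N, X x ∈ N) →
      (∀ x ∈ σ.1.toSubmodule, star X x ∈ σ.1.toSubmodule) →
      ∀ x ∈ N ⊓ σ.1.toSubmoduleᗮ, X x ∈ N ⊓ σ.1.toSubmoduleᗮ := by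
    intro X hX hX' x hx
    refine ⟨hX x hx.1, ?_⟩
    refine (Submodule.mem_orthogonal _ _).mpr fun e he => ?_
    have h := ContinuousLinearMap.adjoint_inner_left X x e
    rw [← h]
    exact (Submodule.mem_orthogonal _ _).mp hx.2 _ (hX' e he)
  have hP : (N ⊓ σ.1.toSubmoduleᗮ).starProjection = N.starProjection - irredProj σ := by
    ext x
    have hx : x - N.starProjection x ∈ Nᗮ := N.sub_starProjection_mem_orthogonal x
    have hxσ : x - irredProj σ x ∈ σ.1.toSubmoduleᗮ :=
      σ.1.toSubmodule.sub_starProjection_mem_orthogonal x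
    have hσ : irredProj σ x ∈ σ.1.toSubmodule := irredProj_apply_mem σ x
    refine Submodule.eq_starProjection_of_mem_orthogonal ⟨?_, ?_⟩ ?_
    · exact N.sub_mem (N.starProjection_apply_mem x) (hσN hσ)
    · have h := Submodule.sub_mem _ hxσ (Submodule.orthogonal_le hσN hx)
      rwa [sub_sub_sub_cancel_left] at h
    · have h := Submodule.add_mem _ (Submodule.orthogonal_le inf_le_left hx)
        (Submodule.orthogonal_le (inf_le_right : N ⊓ σ.1.toSubmoduleᗮ ≤ _)
          (Submodule.le_orthogonal_orthogonal _ hσ))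
      rwa [sub_add] at h
  have hlt : Module.finrank ℂ (N ⊓ σ.1.toSubmoduleᗮ : Submodule ℂ ℋ) < d := by
    rw [← hd]
    refine Submodule.finrank_lt_finrank_of_lt (lt_of_le_of_ne inf_le_left fun h => ?_)
    obtain ⟨x, hx, hx0⟩ := Submodule.exists_mem_ne_zero_of_ne_bot (irred_ne_bot σ)
    have h1 : x ∈ σ.1.toSubmoduleᗮ := (h.symm ▸ hσN hx : x ∈ N ⊓ σ.1.toSubmoduleᗮ).2
    exact hx0 (inner_self_eq_zero.mp ((Submodule.mem_orthogonal _ _).mp h1 x hx))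
  obtain ⟨n, E, c, hE, hsum, hAE⟩ := ih _ hlt (N ⊓ σ.1.toSubmoduleᗮ)
    (fun g x hx => stable (U g : ℋ →L[ℂ] ℋ) (hNU g) (fun y hy => by
      rw [star_apply_group]; exact σ.1.apply_mem_toSubmodule g⁻¹ hy) x hx)
    (stable A hNA fun x hx => by rw [hb x hx]; exact Submodule.smul_mem _ _ hx)
    (stable (star A) hNA' fun x hx => by
      rw [star_star, ha x hx]; exact Submodule.smul_mem _ _ hx) rfl
  -- each new projection is dominated by the projection onto the complement of `σ`
  have hdom : ∀ j, irredProj (E j) * irredProj σ = 0 := by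
    intro j
    have h1 : irredProj (E j) * (∑ i, irredProj (E i)) = irredProj (E j) := by
      rw [Finset.mul_sum, Finset.sum_eq_single j]
      · exact irredProj_mul_self _
      · exact fun i _ hij => hE hij.symm
      · simp
    rw [hsum, hP] at h1
    have h2 : N.starProjection * irredProj σ = irredProj σ := by
      ext x
      exact Submodule.starProjection_eq_self_iff.mpr (hσN (irredProj_apply_mem σ x))
    rw [← h1, mul_assoc, sub_mul, h2, irredProj_mul_self, sub_self, mul_zero]
  have hdom' : ∀ j, irredProj σ * irredProj (E j) = 0 := by
    intro j
    have h := congrArg star (hdom j)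
    rwa [star_mul, (irredProj_isSelfAdjoint _).star_eq, (irredProj_isSelfAdjoint _).star_eq,
      star_zero] at h
  refine ⟨n + 1, Fin.cons σ E, Fin.cons a c, ?_, ?_, ?_⟩
  · intro i j hij
    induction i using Fin.cases with
    | zero =>
      induction j using Fin.cases with
      | zero => exact absurd rfl hij
      | succ j => simpa using hdom' j
    | succ i =>
      induction j using Fin.cases with
      | zero => simpa using hdom i
      | succ j => simpa using hE fun h => hij (congrArg Fin.succ h)
  · rw [Fin.sum_univ_succ]
    simp [hsum, hP]
  · rw [Fin.sum_univ_succ]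
    simp only [Fin.cons_zero, Fin.cons_succ, ← hAE, hP, mul_sub]
    have h : A * irredProj σ = a • irredProj σ := by
      ext x
      exact ha _ (irredProj_apply_mem σ x)
    rw [h]
    abel

/-- A normal operator of the commutant is diagonal with respect to some orthogonal decomposition
of the space into irreducible subspaces. -/
theorem exists_irred_decomposition {A : ℋ →L[ℂ] ℋ} (hA : A ∈ commutant U)
    (hn : Commute A (star A)) :
    ∃ (n : ℕ) (E : Fin n → IrredSub U) (a : Fin n → ℂ),
      IsResolution (fun j => irredProj (E j)) ∧ A = diagOp (fun j => irredProj (E j)) a := by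
  obtain ⟨n, E, a, hE, hsum, hAE⟩ := exists_irred_decomposition_of_stable hA hn ⊤
    (fun _ _ _ => trivial) (fun _ _ => trivial) (fun _ _ => trivial)
  rw [Submodule.starProjection_top'] at hsum hAE
  exact ⟨n, E, a, ⟨⟨⟨fun j => irredProj_mul_self _, hE⟩, hsum⟩,
    fun j => irredProj_isSelfAdjoint _⟩, by rw [← mul_one A]; exact hAE⟩

end

/-! ### Sectors, traces and multiplicities -/

section

variable {ℋ : Type*} [NormedAddCommGroup ℋ] [InnerProductSpace ℂ ℋ]

lemma tr_mul_comm (A B : ℋ →L[ℂ] ℋ) : tr (A * B) = tr (B * A) :=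
  LinearMap.trace_mul_comm ℂ (A : ℋ →ₗ[ℂ] ℋ) (B : ℋ →ₗ[ℂ] ℋ)

lemma tr_sum_smul {J : Type*} (s : Finset J) (z : J → ℂ) (p : J → ℋ →L[ℂ] ℋ) :
    tr (∑ j ∈ s, z j • p j) = ∑ j ∈ s, z j * tr (p j) := by
  simp [tr, map_sum]

lemma tr_starProjection [FiniteDimensional ℂ ℋ] (N : Submodule ℂ ℋ) : tr N.starProjection = Module.finrank ℂ N := by
  refine LinearMap.IsProj.trace (p := N) ⟨fun x => ?_, fun x hx => ?_⟩
  · exact N.starProjection_apply_mem x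
  · exact Submodule.starProjection_eq_self_iff.mpr hx

variable [CompleteSpace ℋ] {G : Type*} [Group G] {U : G →* UGroup ℋ}

lemma irredClass_irrepRepr (μ : Irreps U) : irredClass (irrepRepr U μ) = μ := Quotient.out_eq μ

variable (U) in
/-- The dimension of the irrep `μ`. -/
noncomputable def irrepDim (μ : Irreps U) : ℕ :=
  Module.finrank ℂ (irrepRepr U μ).1.toSubmodule

variable [FiniteDimensional ℂ ℋ]

lemma irrepDim_pos (μ : Irreps U) : 0 < irrepDim U μ := by
  rw [irrepDim, Module.finrank_pos_iff, Submodule.nontrivial_iff_ne_bot]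
  exact irred_ne_bot _

lemma tr_irredProj (σ : IrredSub U) : tr (irredProj σ) = irrepDim U (irredClass σ) := by
  obtain ⟨φ⟩ := irredClass_eq_iff.mp (irredClass_irrepRepr (irredClass σ))
  rw [irredProj, tr_starProjection, irrepDim, φ.toLinearEquiv.finrank_eq]

open scoped Classical in
lemma irredProj_mul_proj (σ : IrredSub U) (μ : Irreps U) :
    irredProj σ * proj U μ = if irredClass σ = μ then irredProj σ else 0 := by
  split_ifs with h
  · refine Submodule.starProjection_comp_starProjection_of_le ?_
    exact le_iSup (fun τ : {τ : IrredSub U // (Quotient.mk (irredSetoid U) τ : Irreps U) = μ} =>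
      τ.1.1.toSubmodule) ⟨σ, h⟩
  · refine Submodule.starProjection_comp_starProjection_eq_zero_iff.mpr ?_
    refine Submodule.isOrtho_iSup_right.mpr fun τ => ?_
    refine Submodule.starProjection_comp_starProjection_eq_zero_iff.mp ?_
    have hne : irredClass τ.1 ≠ irredClass σ := fun h' => h (h'.symm.trans τ.2)
    have h0 := irredProj_mul_mul_eq_zero (one_mem (commutant U)) hne
    rwa [mul_one] at h0

/-- The component in an irreducible subspace of an intertwining map into the whole space. -/
noncomputable def component {V : Type*} [AddCommGroup V] [Module ℂ V] {ρ : Representation ℂ G V}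
    (f : Representation.IntertwiningMap ρ (rep U)) (τ : IrredSub U) :
    Representation.IntertwiningMap ρ τ.1.toRepresentation where
  toLinearMap := ((irredProj τ : ℋ →ₗ[ℂ] ℋ).codRestrict τ.1.toSubmodule
    fun x => irredProj_apply_mem τ x) ∘ₗ f.toLinearMap
  isIntertwining' g := by
    ext x
    change irredProj τ (f (ρ g x)) = rep U g (irredProj τ (f x))
    rw [Representation.IntertwiningMap.isIntertwining, commutant_apply (irredProj_mem_commutant τ)]

/-- The intertwining map into the whole space given by an isomorphism onto an irreducible
subspace. -/
noncomputable def includeIrred {V : Type*} [AddCommGroup V] [Module ℂ V]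
    {ρ : Representation ℂ G V} (τ : IrredSub U) (φ : ρ.Equiv τ.1.toRepresentation) :
    Representation.IntertwiningMap ρ (rep U) where
  toLinearMap := τ.1.toSubmodule.subtype ∘ₗ φ.toLinearMap
  isIntertwining' g := by
    ext x
    exact congrArg Subtype.val
      (Representation.IntertwiningMap.isIntertwining _ _ φ.toIntertwiningMap g x)

namespace IsResolution

variable {J : Type*} [Fintype J] {E : J → IrredSub U}
  (hE : IsResolution fun j => irredProj (E j))
include hE

open scoped Classical in
lemma proj_eq_sum (μ : Irreps U) :
    proj U μ = ∑ j with irredClass (E j) = μ, irredProj (E j) := by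
  rw [← one_mul (proj U μ), ← hE.complete, Finset.sum_mul, Finset.sum_filter]
  exact Finset.sum_congr rfl fun j _ => irredProj_mul_proj _ _

open scoped Classical in
lemma tr_diagOp_mul_proj (z : J → ℂ) (μ : Irreps U) :
    tr (diagOp (fun j => irredProj (E j)) z * proj U μ)
      = (∑ j with irredClass (E j) = μ, z j) * irrepDim U μ := by
  rw [hE.proj_eq_sum, Finset.mul_sum, Finset.sum_congr rfl fun j _ => hE.diagOp_mul_proj z j,
    tr_sum_smul, Finset.sum_mul]
  refine Finset.sum_congr rfl fun j hj => ?_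
  rw [tr_irredProj, (Finset.mem_filter.mp hj).2]

open scoped Classical in
lemma tr_proj (μ : Irreps U) :
    tr (proj U μ) = ((Finset.univ.filter fun j => irredClass (E j) = μ).card : ℂ)
      * irrepDim U μ := by
  have h := hE.tr_diagOp_mul_proj 1 μ
  rw [hE.diagOp_one, one_mul] at h
  simpa using h

/-- The multiplicity space is spanned by the embeddings onto the irreducible summands in the
class `μ`. -/
lemma exists_span_multSpace (μ : Irreps U) :
    ∃ T : {j // irredClass (E j) = μ} → MultSpace U μ,
      Submodule.span ℂ (Set.range T) = ⊤ := by
  classical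
  have φ : ∀ j : {j // irredClass (E j) = μ},
      (irrepRepr U μ).1.toRepresentation.Equiv (E j).1.toRepresentation := fun j =>
    (irredClass_eq_iff.mp ((irredClass_irrepRepr μ).trans j.2.symm)).some
  refine ⟨fun j => includeIrred (E j) (φ j), ?_⟩
  have := (irrepRepr U μ).2
  rw [eq_top_iff]
  rintro f -
  have hc : ∀ j : {j // irredClass (E j) = μ}, ∃ c : ℂ,
      ∀ x, irredProj (E j) (f x) = c • (φ j x : ℋ) := by
    intro j
    obtain ⟨c, hc⟩ :=
      (Representation.IsIrreducible.algebraMap_intertwiningMap_bijective_of_isAlgClosed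
        (ρ := (irrepRepr U μ).1.toRepresentation)).2
        ((φ j).symm.toIntertwiningMap.comp (component f (E j)))
    refine ⟨c, fun x => ?_⟩
    have h1 : c • x = (φ j).symm (component f (E j) x) := congrArg (fun F => F x) hc
    have h2 := congrArg (φ j) h1
    rw [Representation.Equiv.apply_symm_apply, map_smul] at h2
    exact (congrArg Subtype.val h2).symm
  choose c hc using hc
  have hf : f = ∑ j, c j • includeIrred (E j) (φ j) := by
    refine DFunLike.ext _ _ fun x => ?_
    have h1 : f x = ∑ j, irredProj (E j) (f x) := by
      have := congrArg (fun B : ℋ →L[ℂ] ℋ => B (f x)) hE.complete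
      simpa using this.symm
    rw [h1, Representation.IntertwiningMap.sum_apply,
      ← Fintype.sum_subtype_add_sum_subtype (fun j => irredClass (E j) = μ), Fintype.sum_eq_zero
        (fun j : {j // irredClass (E j) ≠ μ} => irredProj (E j) (f x)), add_zero]
    · exact Finset.sum_congr rfl fun j _ => hc j x
    · intro j
      have := (E j.1).2
      rcases Representation.IsIrreducible.bijective_or_eq_zero (component f (E j)) with hb | h0
      · refine absurd ?_ j.2
        exact (irredClass_eq_iff.mpr ⟨Representation.IntertwiningMap.ofBijective _ hb⟩).symm.trans
          (irredClass_irrepRepr μ)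
      · exact congrArg (fun F => ((F x : (E j.1).1.toSubmodule) : ℋ)) h0
  rw [hf]
  exact Submodule.sum_mem _ fun j _ => Submodule.smul_mem _ _ (Submodule.subset_span ⟨j, rfl⟩)

open scoped Classical in
lemma mult_le_card (μ : Irreps U) :
    mult U μ ≤ (Finset.univ.filter fun j => irredClass (E j) = μ).card := by
  obtain ⟨T, hT⟩ := hE.exists_span_multSpace μ
  have h := finrank_range_le_card (R := ℂ) T
  rwa [Set.finrank, hT, finrank_top, Fintype.card_subtype] at h

end IsResolution

variable (U) in
lemma exists_irred_resolution :
    ∃ (n : ℕ) (E : Fin n → IrredSub U), IsResolution fun j => irredProj (E j) := by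
  obtain ⟨n, E, _, hE, _⟩ := exists_irred_decomposition (one_mem (commutant U))
    (Commute.one_left _)
  exact ⟨n, E, hE⟩

lemma mult_pos (μ : Irreps U) : 0 < mult U μ := by
  obtain ⟨n, E, hE⟩ := exists_irred_resolution U
  obtain ⟨T, hT⟩ := hE.exists_span_multSpace μ
  have : Module.Finite ℂ (MultSpace U μ) := by
    classical
    exact ⟨⟨Finset.univ.image T, by simpa using hT⟩⟩
  rw [mult, Module.finrank_pos_iff]
  have hx := Submodule.exists_mem_ne_zero_of_ne_bot (irred_ne_bot (irrepRepr U μ))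
  obtain ⟨x, hx, hx0⟩ := hx
  refine ⟨includeIrred (irrepRepr U μ) (Representation.Equiv.refl _), 0, fun h => hx0 ?_⟩
  exact congrArg (fun F : MultSpace U μ => F ⟨x, hx⟩) h

open scoped Classical in
lemma IsResolution.card_class_pos {J : Type*} [Fintype J] {E : J → IrredSub U}
    (hE : IsResolution fun j => irredProj (E j)) (μ : Irreps U) :
    0 < (Finset.univ.filter fun j => irredClass (E j) = μ).card :=
  (mult_pos μ).trans_le (hE.mult_le_card μ)

instance finite_irreps : Finite (Irreps U) := by
  classical
  obtain ⟨n, E, hE⟩ := exists_irred_resolution U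
  refine Finite.of_surjective (fun j => irredClass (E j)) fun μ => ?_
  obtain ⟨j, hj⟩ := Finset.card_pos.mp (hE.card_class_pos μ)
  exact ⟨j, (Finset.mem_filter.mp hj).2⟩

noncomputable instance fintype_irreps : Fintype (Irreps U) := Fintype.ofFinite _

lemma tr_proj_re_pos (μ : Irreps U) : 0 < (tr (proj U μ)).re := by
  obtain ⟨n, E, hE⟩ := exists_irred_resolution U
  rw [hE.tr_proj, ← Nat.cast_mul, Complex.natCast_re]
  exact_mod_cast Nat.mul_pos (hE.card_class_pos μ) (irrepDim_pos μ)

lemma isResolution_proj : IsResolution (proj U) := by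
  classical
  obtain ⟨n, E, hE⟩ := exists_irred_resolution U
  refine ⟨⟨⟨fun μ => Submodule.isIdempotentElem_starProjection _, fun μ ν hμν => ?_⟩, ?_⟩,
    fun μ => isSelfAdjoint_starProjection _⟩
  · change proj U μ * proj U ν = 0
    rw [hE.proj_eq_sum μ, Finset.sum_mul]
    refine Finset.sum_eq_zero fun j hj => ?_
    rw [irredProj_mul_proj, if_neg]
    rw [(Finset.mem_filter.mp hj).2]
    exact hμν
  · simp_rw [hE.proj_eq_sum]
    rw [Finset.sum_fiberwise Finset.univ (fun j => irredClass (E j)), hE.complete]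

/-- Scalars depending only on the irrep define the same operator for every decomposition into
irreducible subspaces. -/
lemma IsResolution.diagOp_comp_irredClass {J : Type*} [Fintype J] {E : J → IrredSub U}
    (hE : IsResolution fun j => irredProj (E j)) (w : Irreps U → ℂ) :
    diagOp (fun j => irredProj (E j)) (fun j => w (irredClass (E j))) = diagOp (proj U) w := by
  classical
  simp only [diagOp]
  rw [← Finset.sum_fiberwise Finset.univ (fun j => irredClass (E j))]
  refine Finset.sum_congr rfl fun μ _ => ?_
  rw [hE.proj_eq_sum, Finset.smul_sum]
  exact Finset.sum_congr rfl fun j hj => by rw [(Finset.mem_filter.mp hj).2]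

end

/-! ### Diagonal unitaries that are products of commutators -/

section

variable {ℋ : Type*} [NormedAddCommGroup ℋ] [InnerProductSpace ℂ ℋ] [CompleteSpace ℋ]
  {G : Type*} [Group G] {U : G →* UGroup ℋ} {J : Type*} [Fintype J]

lemma IsResolution.diagHom_mem_symUnitaries {p : J → ℋ →L[ℂ] ℋ} (hp : IsResolution p)
    (hU : ∀ j, p j ∈ commutant U) (z : J → Circle) : hp.diagHom z ∈ symUnitaries U :=
  coe_mem_commutant.mp (Subalgebra.sum_mem _ fun j _ => Subalgebra.smul_mem _ (hU j) _)

lemma IsResolution.coe_diagHom_mulSingle [DecidableEq J] {p : J → ℋ →L[ℂ] ℋ}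
    (hp : IsResolution p) (j : J) (u : Circle) :
    (hp.diagHom (Pi.mulSingle j u) : ℋ →L[ℂ] ℋ) = 1 + ((u : ℂ) - 1) • p j := by
  rw [hp.coe_diagHom, ← hp.complete, diagOp, ← Finset.add_sum_erase _ p (Finset.mem_univ j),
    ← Finset.add_sum_erase _ _ (Finset.mem_univ j)]
  have h : ∑ i ∈ Finset.univ.erase j, ((Pi.mulSingle j u : J → Circle) i : ℂ) • p i
      = ∑ i ∈ Finset.univ.erase j, p i :=
    Finset.sum_congr rfl fun i hi => by
      rw [Pi.mulSingle_eq_of_ne (Finset.ne_of_mem_erase hi)]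
      simp
  rw [h, Pi.mulSingle_eq_same, sub_smul, one_smul]
  abel

/-- A partial isometry `B` of the commutant from the range of `P` onto the range of an orthogonal
projection `Q` extends to a unitary of the commutant which conjugates `P` into `Q`: the swap
`B + B* + (1 - P - Q)`. -/
lemma exists_symUnitary_conj {B P Q : ℋ →L[ℂ] ℋ} (hB : B ∈ commutant U)
    (h1 : star B * B = P) (h2 : B * star B = Q) (hP : P * P = P) (hQ : Q * Q = Q)
    (hPQ : P * Q = 0) :
    ∃ S ∈ symUnitaries U, (S : ℋ →L[ℂ] ℋ) * P = Q * (S : ℋ →L[ℂ] ℋ) := by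
  have hPs : star P = P := by rw [← h1, star_mul, star_star]
  have hQs : star Q = Q := by rw [← h2, star_mul, star_star]
  have hQP : Q * P = 0 := by
    have := congrArg star hPQ
    rwa [star_mul, hPs, hQs, star_zero] at this
  have hBP : B * P = B := by
    have h : star (B - B * P) * (B - B * P) = 0 := by
      rw [star_sub, star_mul, hPs, sub_mul, mul_sub, mul_sub, h1, ← mul_assoc (star B), h1, hP,
        mul_assoc P (star B) B, h1, mul_assoc P, ← mul_assoc (star B), h1, hP, hP]
      simp
    exact (sub_eq_zero.mp (CStarRing.star_mul_self_eq_zero_iff _ |>.mp h)).symm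
  have hQB : Q * B = B := by rw [← h2, mul_assoc, h1, hBP]
  have hPB : P * star B = star B := by
    have := congrArg star hBP
    rwa [star_mul, hPs] at this
  have hBQ : star B * Q = star B := by
    have := congrArg star hQB
    rwa [star_mul, hQs] at this
  have hBB : B * B = 0 := by
    rw [← hQB, mul_assoc, ← mul_assoc B, ← hBP, mul_assoc B P Q, hPQ, mul_zero, zero_mul, mul_zero]
  have hBB' : star B * star B = 0 := by rw [← star_mul, hBB, star_zero]
  have hBQ0 : B * Q = 0 := by rw [← hBP, mul_assoc, hPQ, mul_zero]
  have hPB0 : P * B = 0 := by rw [← hQB, ← mul_assoc, hPQ, zero_mul]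
  have hBP0 : star B * P = 0 := by rw [← hBQ, mul_assoc, hQP, mul_zero]
  have hQB0 : Q * star B = 0 := by rw [← hPB, ← mul_assoc, hQP, zero_mul]
  set S : ℋ →L[ℂ] ℋ := B + star B + (1 - P - Q) with hS
  have hSs : star S = S := by
    simp only [hS, star_add, star_sub, star_star, star_one, hPs, hQs]
    abel
  have hSS : S * S = 1 := by
    simp only [hS, add_mul, mul_add, sub_mul, mul_sub, one_mul, mul_one, h1, h2, hP, hQ, hPQ, hQP,
      hBP, hQB, hPB, hBQ, hBB, hBB', hBQ0, hPB0, hBP0, hQB0]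
    abel
  refine ⟨⟨S, ?_⟩, coe_mem_commutant.mp ?_, ?_⟩
  · rw [Unitary.mem_iff, hSs]
    exact ⟨hSS, hSS⟩
  · have hPc : P ∈ commutant U := h1 ▸ mul_mem (star_mem_commutant hB) hB
    have hQc : Q ∈ commutant U := h2 ▸ mul_mem hB (star_mem_commutant hB)
    exact add_mem (add_mem hB (star_mem_commutant hB)) (sub_mem (sub_mem (one_mem _) hPc) hQc)
  · change S * P = Q * S
    simp only [hS, add_mul, mul_add, sub_mul, mul_sub, one_mul, mul_one, hP, hQ, hQP,
      hBP, hQB, hBP0, hQB0]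
    abel

variable [FiniteDimensional ℂ ℋ] {E : J → IrredSub U}

/-- Opposite phases on two equivalent irreducible summands form a commutator: of the first phase
and of a unitary swapping the two summands. -/
lemma IsResolution.diagHom_pair_mem [DecidableEq J] (hE : IsResolution fun j => irredProj (E j))
    {i j : J} (hij : irredClass (E i) = irredClass (E j)) (u : Circle) :
    hE.diagHom (Pi.mulSingle i u * Pi.mulSingle j u⁻¹) ∈ specialSymUnitaries U := by
  by_cases hne : i = j
  · subst hne
    rw [← Pi.mulSingle_mul, mul_inv_cancel, Pi.mulSingle_one, map_one]
    exact one_mem _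
  obtain ⟨B, hB, h1, h2⟩ := exists_partialIsometry hij
  obtain ⟨S, hS, hSP⟩ := exists_symUnitary_conj hB h1 h2 (irredProj_mul_self _)
    (irredProj_mul_self _) (hE.ortho hne)
  set D := hE.diagHom (Pi.mulSingle i u)
  have hD : D ∈ symUnitaries U :=
    hE.diagHom_mem_symUnitaries (fun j => irredProj_mem_commutant _) _
  have hconj : S * D⁻¹ = hE.diagHom (Pi.mulSingle j u⁻¹) * S := by
    rw [← map_inv, ← Pi.mulSingle_inv]
    apply Subtype.ext
    rw [Submonoid.coe_mul, Submonoid.coe_mul, hE.coe_diagHom_mulSingle, hE.coe_diagHom_mulSingle,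
      mul_add, mul_smul_comm, hSP, add_mul, smul_mul_assoc, mul_one, one_mul]
  have heq : hE.diagHom (Pi.mulSingle i u * Pi.mulSingle j u⁻¹) = D * S * D⁻¹ * S⁻¹ := by
    rw [mul_assoc D S, hconj, map_mul, ← mul_assoc,
      mul_inv_cancel_right]
  rw [heq]
  exact Subgroup.commutator_mem_commutator hD hS

open scoped Classical in
/-- A diagonal unitary whose phases multiply to `1` over each isotypic class is a product of
commutators of symmetric unitaries. -/
theorem IsResolution.diagHom_mem_specialSymUnitaries
    (hE : IsResolution fun j => irredProj (E j)) (z : J → Circle)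
    (hz : ∀ μ, ∏ j with irredClass (E j) = μ, z j = 1) :
    hE.diagHom z ∈ specialSymUnitaries U := by
  -- a base point of each class
  choose r hr using fun μ => Finset.card_pos.mp (hE.card_class_pos μ)
  have hr' : ∀ μ, irredClass (E (r μ)) = μ := fun μ => (Finset.mem_filter.mp (hr μ)).2
  have hbase : ∏ j, (Pi.mulSingle (r (irredClass (E j))) (z j)⁻¹ : J → Circle) = 1 := by
    rw [← Finset.prod_fiberwise Finset.univ (fun j => irredClass (E j))]
    refine Finset.prod_eq_one fun μ _ => ?_
    have h : ∀ j ∈ Finset.univ.filter (fun j => irredClass (E j) = μ),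
        (Pi.mulSingle (r (irredClass (E j))) (z j)⁻¹ : J → Circle)
          = MonoidHom.mulSingle (fun _ : J => Circle) (r μ) (z j)⁻¹ := fun j hj => by
      rw [(Finset.mem_filter.mp hj).2, MonoidHom.mulSingle_apply]
    rw [Finset.prod_congr rfl h, ← map_prod, Finset.prod_inv_distrib, hz, inv_one, map_one]
  have hprod : z = ∏ j, (Pi.mulSingle j (z j) * Pi.mulSingle (r (irredClass (E j))) (z j)⁻¹) := by
    rw [Finset.prod_mul_distrib, hbase, Finset.univ_prod_mulSingle, mul_one]
  rw [hprod]
  exact Subgroup.prod_mem ((specialSymUnitaries U).comap hE.diagHom) fun j _ => hE.diagHom_pair_mem (hr' _).symm _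

/-- If the `m`-th power of the phase `w μ` (with `m` the number of summands in the class `μ`) is the
product of the phases `z j` over that class, then `z` and `w` define the same symmetric unitary up
to commutators. -/
lemma IsResolution.exists_diagHom_eq_mul (hE : IsResolution fun j => irredProj (E j))
    (z : J → Circle) (w : Irreps U → Circle)
    (hw : open scoped Classical in ∀ μ, ∏ j with irredClass (E j) = μ, z j
      = w μ ^ (Finset.univ.filter fun j => irredClass (E j) = μ).card) :
    ∃ s ∈ specialSymUnitaries U, hE.diagHom z = isResolution_proj.diagHom w * s := by
  classical
  refine ⟨hE.diagHom fun j => (w (irredClass (E j)))⁻¹ * z j,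
    hE.diagHom_mem_specialSymUnitaries _ fun μ => ?_, ?_⟩
  · rw [Finset.prod_mul_distrib, hw, Finset.prod_congr rfl fun j hj => by
      rw [(Finset.mem_filter.mp hj).2], Finset.prod_const, ← mul_pow, inv_mul_cancel, one_pow]
  · have h : isResolution_proj.diagHom w = hE.diagHom fun j => w (irredClass (E j)) :=
      Subtype.ext (hE.diagOp_comp_irredClass fun μ => (w μ : ℂ)).symm
    rw [h, ← map_mul]
    congr 1
    ext j
    simp

lemma re_mul_natCast (z : ℂ) (n : ℕ) : (z * n).re = z.re * n := by
  simp [Complex.mul_re]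

lemma circle_exp_sum {J : Type*} (s : Finset J) (x : J → ℝ) :
    Circle.exp (∑ j ∈ s, x j) = ∏ j ∈ s, Circle.exp (x j) :=
  map_sum Circle.expHom x s

lemma exists_circle_pow_eq {m : ℕ} (hm : 0 < m) (z : Circle) : ∃ w : Circle, w ^ m = z := by
  refine ⟨Circle.exp (Complex.arg z / m), ?_⟩
  rw [← Circle.exp_nsmul, nsmul_eq_mul, mul_div_cancel₀ _ (by exact_mod_cast hm.ne'),
    Circle.exp_arg]

/-- Every symmetric unitary is a product of central phases and commutators. -/
theorem exists_eq_central_mul {V : UGroup ℋ} (hV : V ∈ symUnitaries U) :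
    ∃ w : Irreps U → Circle, ∃ s ∈ specialSymUnitaries U,
      V = isResolution_proj.diagHom w * s := by
  classical
  have hVU := coe_mem_commutant.mpr hV
  have hV1 : star (V : ℋ →L[ℂ] ℋ) * V = 1 := Unitary.star_mul_self_of_mem V.2
  have hV2 : (V : ℋ →L[ℂ] ℋ) * star (V : ℋ →L[ℂ] ℋ) = 1 := Unitary.mul_star_self_of_mem V.2
  obtain ⟨n, E, a, hE, hVa⟩ := exists_irred_decomposition hVU (hV2.trans hV1.symm)
  have ha : ∀ j, a j * star (a j) = 1 := by
    intro j
    have h := hE.diagOp_mul_proj (a * star a) j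
    rw [← hE.diagOp_mul, ← hE.star_diagOp, ← hVa, hV2, one_mul] at h
    have h2 : ((a * star a) j - 1) • irredProj (E j) = 0 := by
      rw [sub_smul, ← h, one_smul, sub_self]
    exact sub_eq_zero.mp ((smul_eq_zero.mp h2).resolve_right (irredProj_ne_zero _))
  let z : Fin n → Circle := fun j => ⟨a j, by
    have h := ha j
    rw [Complex.star_def, Complex.mul_conj] at h
    have h' : Complex.normSq (a j) = 1 := by exact_mod_cast h
    refine mem_sphere_zero_iff_norm.mpr ?_
    rw [← sq_eq_sq₀ (norm_nonneg _) zero_le_one, one_pow,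
      ← Complex.normSq_eq_norm_sq, h']⟩
  have hVz : V = hE.diagHom z := Subtype.ext hVa
  choose w hw using fun μ => exists_circle_pow_eq (hE.card_class_pos μ)
    (∏ j with irredClass (E j) = μ, z j)
  obtain ⟨s, hs, h⟩ := hE.exists_diagHom_eq_mul z w fun μ => (hw μ).symm
  exact ⟨w, s, hs, hVz.trans h⟩

open scoped Classical in
/-- The central element acting on the sector of `μ` by a root of unity of order at least the
multiplicity of `μ`, and trivially on the other sectors, is a product of commutators. -/
lemma exists_central_rootOfUnity_mem (μ : Irreps U) :
    ∃ m : ℕ, mult U μ ≤ m ∧ 0 < m ∧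
      isResolution_proj.diagHom (Pi.mulSingle μ (Circle.exp (2 * Real.pi / m)))
        ∈ specialSymUnitaries U := by
  obtain ⟨n, E, hE⟩ := exists_irred_resolution U
  have hm := hE.card_class_pos μ
  refine ⟨(Finset.univ.filter fun j => irredClass (E j) = μ).card, hE.mult_le_card μ, hm, ?_⟩
  set m := (Finset.univ.filter fun j => irredClass (E j) = μ).card
  obtain ⟨s, hs, h⟩ := hE.exists_diagHom_eq_mul 1
    (Pi.mulSingle μ (Circle.exp (2 * Real.pi / m))) fun ν => by
      by_cases hν : ν = μ
      · subst hν
        rw [Pi.mulSingle_eq_same, ← Circle.exp_nsmul, nsmul_eq_mul,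
          mul_div_cancel₀ _ (by exact_mod_cast hm.ne')]
        simp
      · rw [Pi.mulSingle_eq_of_ne hν]
        simp
  rw [map_one] at h
  rw [eq_inv_of_mul_eq_one_left h.symm]
  exact inv_mem hs

/-- The exponential of a Hermitian operator `A` of the commutant agrees, up to commutators, with
the central phases given by the averages `Tr (A Π_μ) / Tr Π_μ` of `A` over the sectors. -/
theorem exists_exp_eq_central_mul {A : ℋ →L[ℂ] ℋ} (hA : IsInvariantHamiltonian U A) (t : ℝ) :
    ∃ V : UGroup ℋ, (V : ℋ →L[ℂ] ℋ) = NormedSpace.exp ((Complex.I * (t : ℂ)) • A) ∧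
      ∃ s ∈ specialSymUnitaries U, V = isResolution_proj.diagHom
        (fun μ => Circle.exp (t * ((tr (A * proj U μ)).re / (tr (proj U μ)).re))) * s := by
  classical
  have hAc : A ∈ commutant U := mem_commutant.mpr hA.2
  have hAs : star A = A := hA.1
  obtain ⟨n, E, a, hE, hAa⟩ := exists_irred_decomposition hAc
    (show Commute A (star A) by rw [hAs])
  have hreal : ∀ j, ((a j).re : ℂ) = a j := by
    intro j
    have h1 := hE.diagOp_mul_proj a j
    have h2 := hE.diagOp_mul_proj (star a) j
    rw [← hE.star_diagOp, ← hAa, hAs, hAa, h1] at h2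
    exact Complex.conj_eq_iff_re.mp (smul_left_injective ℂ (irredProj_ne_zero (E j)) h2).symm
  let z : Fin n → Circle := fun j => Circle.exp (t * (a j).re)
  refine ⟨hE.diagHom z, ?_, hE.exists_diagHom_eq_mul z _ fun μ => ?_⟩
  · have h : (Complex.I * (t : ℂ)) • A
        = diagOp (fun j => irredProj (E j)) fun j => Complex.I * t * a j := by
      rw [hAa, diagOp, diagOp, Finset.smul_sum]
      simp only [smul_smul]
    rw [h, hE.exp_diagOp, hE.coe_diagHom]
    congr 1
    ext j
    rw [Circle.coe_exp, ← hreal j]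
    congr 1
    push_cast
    simp only [Complex.ofReal_re]
    ring
  · have hm : ((Finset.univ.filter fun j => irredClass (E j) = μ).card : ℝ) ≠ 0 := by
      exact_mod_cast (hE.card_class_pos μ).ne'
    have hd : (irrepDim U μ : ℝ) ≠ 0 := by exact_mod_cast (irrepDim_pos μ).ne'
    have h1 : (tr (A * proj U μ)).re
        = (∑ j with irredClass (E j) = μ, (a j).re) * irrepDim U μ := by
      rw [hAa, hE.tr_diagOp_mul_proj, re_mul_natCast, Complex.re_sum]
    have h2 : (tr (proj U μ)).re = ((Finset.univ.filter fun j => irredClass (E j) = μ).card : ℝ)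
        * irrepDim U μ := by
      rw [hE.tr_proj, re_mul_natCast, Complex.natCast_re]
    rw [← Circle.exp_nsmul, nsmul_eq_mul, h1, h2]
    have h3 : (∏ j with irredClass (E j) = μ, z j)
        = Circle.exp (∑ j with irredClass (E j) = μ, t * (a j).re) := by
      rw [circle_exp_sum]
    rw [h3, ← Finset.mul_sum]
    congr 1
    field_simp

end

/-! ### Mixed tensor powers -/

section

variable {ℋ : Type*} [NormedAddCommGroup ℋ] [InnerProductSpace ℂ ℋ]
  {κ : Type*} [Fintype κ] [DecidableEq κ] (b : OrthonormalBasis κ ℂ ℋ) {t : ℕ}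

/-- The matrix of an operator with respect to an orthonormal basis. -/
noncomputable def opMatrix (A : ℋ →L[ℂ] ℋ) : Matrix κ κ ℂ :=
  LinearMap.toMatrix b.toBasis b.toBasis (A : ℋ →ₗ[ℂ] ℋ)

lemma opMatrix_mul (A B : ℋ →L[ℂ] ℋ) : opMatrix b (A * B) = opMatrix b A * opMatrix b B :=
  LinearMap.toMatrix_mul _ _ _

lemma opMatrix_one : opMatrix b 1 = 1 := LinearMap.toMatrix_one _

lemma opMatrix_smul (c : ℂ) (A : ℋ →L[ℂ] ℋ) : opMatrix b (c • A) = c • opMatrix b A := by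
  simp [opMatrix]

lemma opMatrix_sum {J : Type*} (s : Finset J) (A : J → ℋ →L[ℂ] ℋ) :
    opMatrix b (∑ j ∈ s, A j) = ∑ j ∈ s, opMatrix b (A j) := by
  simp [opMatrix, map_sum]

lemma opMatrix_apply (A : ℋ →L[ℂ] ℋ) (i j : κ) : opMatrix b A i j = inner ℂ (b i) (A (b j)) := by
  simp [opMatrix, LinearMap.toMatrix_apply, OrthonormalBasis.repr_apply_apply]

/-- The matrix of `A₁ ⊗ ⋯ ⊗ A_t ⊗ B₁* ⊗ ⋯ ⊗ B_t*`, where `*` is complex conjugation. -/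
noncomputable def mixedTensor (A B : Fin t → ℋ →L[ℂ] ℋ) :
    Matrix ((Fin t → κ) × (Fin t → κ)) ((Fin t → κ) × (Fin t → κ)) ℂ :=
  Matrix.of fun i j =>
    (∏ a, opMatrix b (A a) (i.1 a) (j.1 a)) * ∏ a, star (opMatrix b (B a) (i.2 a) (j.2 a))

lemma mixedTensor_mul (A B A' B' : Fin t → ℋ →L[ℂ] ℋ) :
    mixedTensor b A B * mixedTensor b A' B' = mixedTensor b (A * A') (B * B') := by
  ext i j
  simp only [Matrix.mul_apply, mixedTensor, Matrix.of_apply, Pi.mul_apply, opMatrix_mul, star_sum,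
    star_mul']
  rw [Finset.prod_univ_sum, Finset.prod_univ_sum, Finset.sum_mul_sum, Fintype.sum_prod_type]
  simp only [Fintype.piFinset_univ, Finset.prod_mul_distrib]
  exact Finset.sum_congr rfl fun k _ => Finset.sum_congr rfl fun l _ => by ring

lemma mixedTensor_one : mixedTensor b (1 : Fin t → ℋ →L[ℂ] ℋ) 1 = 1 := by
  have h : ∀ i j : Fin t → κ, ∏ a, (1 : Matrix κ κ ℂ) (i a) (j a) = if i = j then 1 else 0 := by
    intro i j
    split_ifs with hij
    · subst hij
      exact Finset.prod_eq_one fun a _ => Matrix.one_apply_eq _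
    · obtain ⟨a, ha⟩ := Function.ne_iff.mp hij
      exact Finset.prod_eq_zero (Finset.mem_univ a) (Matrix.one_apply_ne ha)
  ext i j
  simp only [mixedTensor, Matrix.of_apply, Pi.one_apply, opMatrix_one, ← star_prod, h]
  rw [Matrix.one_apply]
  by_cases h1 : i.1 = j.1 <;> by_cases h2 : i.2 = j.2 <;> simp [Prod.ext_iff, h1, h2]

lemma mixedTensor_smul (c d : Fin t → ℂ) (A B : Fin t → ℋ →L[ℂ] ℋ) :
    mixedTensor b (fun a => c a • A a) (fun a => d a • B a)
      = ((∏ a, c a) * ∏ a, star (d a)) • mixedTensor b A B := by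
  ext i j
  simp only [mixedTensor, Matrix.of_apply, Matrix.smul_apply, opMatrix_smul, smul_eq_mul,
    star_mul', Finset.prod_mul_distrib]
  ring

/-- A resolution of the identity `p` induces the resolution of the identity on the mixed tensor
power by the products `p (f 1) ⊗ ⋯ ⊗ p (f t) ⊗ p (g 1)* ⊗ ⋯ ⊗ p (g t)*`. -/
lemma sum_mixedTensor {J : Type*} [Fintype J] [DecidableEq J] {p : J → ℋ →L[ℂ] ℋ}
    (hp : ∑ j, p j = 1) :
    ∑ f : Fin t → J, ∑ g : Fin t → J, mixedTensor b (fun a => p (f a)) (fun a => p (g a)) = 1 := by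
  rw [← mixedTensor_one b]
  ext i j
  simp only [Matrix.sum_apply, mixedTensor, Matrix.of_apply, Pi.one_apply, ← hp, opMatrix_sum,
    star_sum]
  rw [Finset.prod_univ_sum, Finset.prod_univ_sum, Finset.sum_mul_sum]
  simp only [Fintype.piFinset_univ]

variable (t) in
/-- The matrix of `A^{⊗t} ⊗ (A^*)^{⊗t}`. -/
noncomputable def tensorRep (A : ℋ →L[ℂ] ℋ) :
    Matrix ((Fin t → κ) × (Fin t → κ)) ((Fin t → κ) × (Fin t → κ)) ℂ :=
  mixedTensor b (fun _ : Fin t => A) fun _ => A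

lemma tensorRep_mul (A B : ℋ →L[ℂ] ℋ) :
    tensorRep b t (A * B) = tensorRep b t A * tensorRep b t B :=
  (mixedTensor_mul b _ _ _ _).symm

lemma continuous_tensorRep_apply (i j : (Fin t → κ) × (Fin t → κ)) :
    Continuous fun A : ℋ →L[ℂ] ℋ => tensorRep b t A i j := by
  have h : ∀ k l, Continuous fun A : ℋ →L[ℂ] ℋ => opMatrix b A k l := fun k l => by
    simp only [opMatrix_apply]
    fun_prop
  simp only [tensorRep, mixedTensor, Matrix.of_apply]
  exact (continuous_finsetProd _ fun a _ => h _ _).mul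
    (continuous_finsetProd _ fun a _ => (h _ _).star)

end

/-! ### Moments of the uniform measure of a compact group -/

section

variable {ℋ : Type*} [NormedAddCommGroup ℋ] [InnerProductSpace ℂ ℋ] [CompleteSpace ℋ]
  {κ : Type*} [Fintype κ] [DecidableEq κ]
  (b : OrthonormalBasis κ ℂ ℋ) {t : ℕ}

/-- A left Haar measure of a compact group is also right invariant, by uniqueness. -/
lemma isMulRightInvariant_haarMeasure_top {K : Type*} [Group K] [TopologicalSpace K]
    [IsTopologicalGroup K] [CompactSpace K] [SecondCountableTopology K]
    [MeasurableSpace K] [BorelSpace K] :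
    (Measure.haarMeasure (⊤ : TopologicalSpace.PositiveCompacts K)).IsMulRightInvariant := by
  refine ⟨fun g => ?_⟩
  set μ := Measure.haarMeasure (⊤ : TopologicalSpace.PositiveCompacts K)
  have h := Measure.haarMeasure_unique (Measure.map (· * g) μ)
    (⊤ : TopologicalSpace.PositiveCompacts K)
  have h1 : Measure.map (· * g) μ ((⊤ : TopologicalSpace.PositiveCompacts K) : Set K) = 1 := by
    rw [TopologicalSpace.PositiveCompacts.coe_top,
      Measure.map_apply (measurable_mul_const g) MeasurableSet.univ, Set.preimage_univ]
    exact Measure.haarMeasure_self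
  rw [h, h1, one_smul]

lemma isProbabilityMeasure_haarMeasure_top {K : Type*} [Group K] [TopologicalSpace K]
    [IsTopologicalGroup K] [CompactSpace K] [MeasurableSpace K] [BorelSpace K] :
    IsProbabilityMeasure (Measure.haarMeasure (⊤ : TopologicalSpace.PositiveCompacts K)) :=
  ⟨Measure.haarMeasure_self⟩

lemma moment_uniformMeasure_apply (K : Subgroup (UGroup ℋ)) [CompactSpace K]
    (i j : (Fin t → κ) × (Fin t → κ)) :
    moment b (uniformMeasure K) t i j =
      ∫ V : K, tensorRep b t ((V : UGroup ℋ) : ℋ →L[ℂ] ℋ) i j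
        ∂(Measure.haarMeasure (⊤ : TopologicalSpace.PositiveCompacts K)) := by
  have hc : Continuous fun V : UGroup ℋ => tensorRep b t (V : ℋ →L[ℂ] ℋ) i j :=
    (continuous_tensorRep_apply b i j).comp continuous_subtype_val
  exact integral_map measurable_subtype_coe.aemeasurable hc.aestronglyMeasurable

lemma integrable_tensorRep (K : Subgroup (UGroup ℋ)) [CompactSpace K]
    (i j : (Fin t → κ) × (Fin t → κ)) :
    Integrable (fun V : K => tensorRep b t ((V : UGroup ℋ) : ℋ →L[ℂ] ℋ) i j)
      (Measure.haarMeasure (⊤ : TopologicalSpace.PositiveCompacts K)) := by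
  have hc : Continuous fun V : K => tensorRep b t ((V : UGroup ℋ) : ℋ →L[ℂ] ℋ) i j :=
    (continuous_tensorRep_apply b i j).comp (continuous_subtype_val.comp continuous_subtype_val)
  exact hc.integrable_of_hasCompactSupport (HasCompactSupport.of_compactSpace _)

lemma tensorRep_mul_moment (K : Subgroup (UGroup ℋ)) [CompactSpace K] {V : UGroup ℋ}
    (hV : V ∈ K) :
    tensorRep b t (V : ℋ →L[ℂ] ℋ) * moment b (uniformMeasure K) t
      = moment b (uniformMeasure K) t := by
  ext i j
  simp only [Matrix.mul_apply, moment_uniformMeasure_apply]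
  simp_rw [← integral_const_mul]
  rw [← integral_finsetSum _ fun k _ => (integrable_tensorRep b K k j).const_mul _]
  refine Eq.trans ?_ (integral_mul_left_eq_self
    (fun W : K => tensorRep b t ((W : UGroup ℋ) : ℋ →L[ℂ] ℋ) i j) (⟨V, hV⟩ : K))
  refine integral_congr_ae (Filter.Eventually.of_forall fun W => ?_)
  simp only [Subgroup.coe_mul, Submonoid.coe_mul, tensorRep_mul, Matrix.mul_apply]

lemma moment_mul_of_forall (K : Subgroup (UGroup ℋ)) [CompactSpace K]
    {M : Matrix ((Fin t → κ) × (Fin t → κ)) ((Fin t → κ) × (Fin t → κ)) ℂ}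
    (h : ∀ V ∈ K, tensorRep b t (V : ℋ →L[ℂ] ℋ) * M = M) :
    moment b (uniformMeasure K) t * M = M := by
  have := isProbabilityMeasure_haarMeasure_top (K := K)
  ext i j
  simp only [Matrix.mul_apply, moment_uniformMeasure_apply]
  simp_rw [← integral_mul_const]
  rw [← integral_finsetSum _ fun k _ => (integrable_tensorRep b K i k).mul_const _]
  have hc : ∀ V : K, ∑ k, tensorRep b t ((V : UGroup ℋ) : ℋ →L[ℂ] ℋ) i k * M k j = M i j :=
    fun V => by rw [← Matrix.mul_apply, h V V.2]
  simp [hc]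

lemma mul_moment_of_forall (K : Subgroup (UGroup ℋ)) [CompactSpace K]
    {M : Matrix ((Fin t → κ) × (Fin t → κ)) ((Fin t → κ) × (Fin t → κ)) ℂ}
    (h : ∀ V ∈ K, M * tensorRep b t (V : ℋ →L[ℂ] ℋ) = M) :
    M * moment b (uniformMeasure K) t = M := by
  have := isProbabilityMeasure_haarMeasure_top (K := K)
  ext i j
  simp only [Matrix.mul_apply, moment_uniformMeasure_apply]
  simp_rw [← integral_const_mul]
  rw [← integral_finsetSum _ fun k _ => (integrable_tensorRep b K k j).const_mul _]
  have hc : ∀ V : K, ∑ k, M i k * tensorRep b t ((V : UGroup ℋ) : ℋ →L[ℂ] ℋ) k j = M i j :=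
    fun V => by rw [← Matrix.mul_apply, h V V.2]
  simp [hc]

variable [FiniteDimensional ℂ ℋ]

lemma moment_mul_tensorRep (K : Subgroup (UGroup ℋ)) [CompactSpace K] {V : UGroup ℋ}
    (hV : V ∈ K) :
    moment b (uniformMeasure K) t * tensorRep b t (V : ℋ →L[ℂ] ℋ)
      = moment b (uniformMeasure K) t := by
  have := isMulRightInvariant_haarMeasure_top (K := K)
  ext i j
  simp only [Matrix.mul_apply, moment_uniformMeasure_apply]
  simp_rw [← integral_mul_const]
  rw [← integral_finsetSum _ fun k _ => (integrable_tensorRep b K i k).mul_const _]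
  refine Eq.trans ?_ (integral_mul_right_eq_self
    (fun W : K => tensorRep b t ((W : UGroup ℋ) : ℋ →L[ℂ] ℋ) i j) (⟨V, hV⟩ : K))
  refine integral_congr_ae (Filter.Eventually.of_forall fun W => ?_)
  simp only [Subgroup.coe_mul, Submonoid.coe_mul, tensorRep_mul, Matrix.mul_apply]

/-- A compact subgroup `W ≤ K` has the same `t`-th moment as `K` as soon as `K` fixes the moment
of `W`. -/
lemma moment_eq_of_forall {W K : Subgroup (UGroup ℋ)} [CompactSpace W] [CompactSpace K]
    (hWK : W ≤ K)
    (h : ∀ V ∈ K, tensorRep b t (V : ℋ →L[ℂ] ℋ) * moment b (uniformMeasure W) t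
      = moment b (uniformMeasure W) t) :
    moment b (uniformMeasure W) t = moment b (uniformMeasure K) t := by
  rw [← moment_mul_of_forall b K h]
  exact mul_moment_of_forall b W fun V hV => moment_mul_tensorRep b K (hWK hV)

end

/-! ### Rank conditions -/

section

/-- Vectors span the whole coordinate space exactly when only the zero vector is orthogonal to all
of them. -/
lemma finrank_span_range_eq_card_iff {ι δ : Type*} [Fintype δ] (v : ι → δ → ℝ) :
    Module.finrank ℝ (Submodule.span ℝ (Set.range v)) = Fintype.card δ ↔
      ∀ y : δ → ℝ, (∀ l, v l ⬝ᵥ y = 0) → y = 0 := by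
  classical
  constructor
  · intro h y hy
    have htop : Submodule.span ℝ (Set.range v) = ⊤ :=
      Submodule.eq_top_of_finrank_eq (by rw [h, Module.finrank_fintype_fun_eq_card])
    have hle : Submodule.span ℝ (Set.range v) ≤ LinearMap.ker ((dotProductBilin ℝ ℝ).flip y) := by
      rw [Submodule.span_le]
      rintro _ ⟨l, rfl⟩
      exact hy l
    have hyy : y ⬝ᵥ y = 0 := hle (htop ▸ Submodule.mem_top : y ∈ Submodule.span ℝ (Set.range v))
    exact dotProduct_self_eq_zero.mp hyy
  · intro h
    have htop : Submodule.span ℝ (Set.range v) = ⊤ := by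
      by_contra hne
      obtain ⟨f, hf0, hf⟩ := Submodule.exists_le_ker_of_lt_top _ (lt_top_iff_ne_top.mpr hne)
      have hfy : ∀ x, f x = x ⬝ᵥ fun i => f (Pi.single i 1) := by
        intro x
        conv_lhs => rw [pi_eq_sum_univ' x, map_sum]
        simp [dotProduct]
      refine hf0 (LinearMap.ext fun x => ?_)
      have hy := h _ fun l => by
        rw [← hfy]
        exact hf (Submodule.subset_span ⟨l, rfl⟩)
      rw [hfy, hy, dotProduct_zero]
      rfl
    rw [htop, finrank_top, Module.finrank_fintype_fun_eq_card]

lemma rank_eq_card_iff {ι δ : Type*} [Fintype δ] (A : Matrix ι δ ℝ) :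
    A.rank = Fintype.card δ ↔ ∀ x : δ → ℝ, A.mulVec x = 0 → x = 0 := by
  have h := LinearMap.finrank_range_add_finrank_ker A.mulVecLin
  rw [Module.finrank_fintype_fun_eq_card] at h
  rw [Matrix.rank, ← Matrix.ker_mulVecLin_eq_bot_iff, ← Submodule.finrank_eq_zero (R := ℝ)]
  omega

variable {ℋ : Type*} [NormedAddCommGroup ℋ] [InnerProductSpace ℂ ℋ] [CompleteSpace ℋ]
  [FiniteDimensional ℂ ℋ] {G : Type*} [Group G] {U : G →* UGroup ℋ} {ι : Type*}
  {H : ι → ℋ →L[ℂ] ℋ} {Δ : Finset (Irreps U)}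

lemma phasesFree_iff : PhasesFree U H Δ ↔
    ∀ y : Δ → ℝ, (∀ l, chiVec U Δ (H l) ⬝ᵥ y = 0) → y = 0 := by
  rw [PhasesFree, ← Fintype.card_coe]
  exact finrank_span_range_eq_card_iff fun l => chiVec U Δ (H l)

/-- The columns of `M^Δ` are nonzero multiples of those of the matrix with rows `chiVec`. -/
theorem phasesFree_iff_rank : PhasesFree U H Δ ↔ (phaseMatrix U H Δ).rank = Δ.card := by
  rw [phasesFree_iff, ← Fintype.card_coe, rank_eq_card_iff]
  let c : Δ → ℝ := fun μ => mult U μ.1 / (tr (proj U μ.1)).re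
  have hc : ∀ μ, c μ ≠ 0 := fun μ =>
    (div_pos (by exact_mod_cast mult_pos μ.1) (tr_proj_re_pos μ.1)).ne'
  have key : ∀ (x : Δ → ℝ) (l : ι),
      (phaseMatrix U H Δ).mulVec x l = chiVec U Δ (H l) ⬝ᵥ fun μ => c μ * x μ := by
    intro x l
    simp only [Matrix.mulVec, dotProduct, phaseMatrix, Matrix.of_apply, chiVec, c]
    refine Finset.sum_congr rfl fun μ _ => ?_
    rw [tr_mul_comm (proj U μ.1)]
    ring
  constructor
  · intro h x hx
    have hy := h (fun μ => c μ * x μ) fun l => by rw [← key, hx]; rfl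
    ext μ
    exact (mul_eq_zero.mp (congrFun hy μ)).resolve_left (hc μ)
  · intro h y hy
    have hx := h (fun μ => y μ / c μ) (by
      ext l
      rw [key]
      have : (fun μ => c μ * (y μ / c μ)) = y := by
        ext μ
        exact mul_div_cancel₀ _ (hc μ)
      rw [this, hy]
      rfl)
    ext μ
    exact (div_eq_zero_iff.mp (congrFun hx μ)).resolve_right (hc μ)

end

/-! ### Weights of the central torus -/

section

lemma eq_zero_of_forall_exp_mul_eq_one {c : ℝ} (h : ∀ s : ℝ, Circle.exp (s * c) = 1) : c = 0 := by
  by_contra hc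
  refine Circle.exp_pi_ne_one ?_
  have := h (Real.pi / c)
  rwa [div_mul_cancel₀ _ hc] at this

/-- A primitive `m`-th root of unity has no trivial power with a nonzero exponent below `m` in
absolute value. -/
lemma eq_zero_of_exp_two_pi_div_zpow {m : ℕ} (hm : 0 < m) {k : ℤ} (hk : |k| < m)
    (h : Circle.exp (2 * Real.pi / m) ^ k = 1) : k = 0 := by
  rw [← Circle.exp_intCast_mul, Circle.exp_eq_one] at h
  obtain ⟨n, hn⟩ := h
  have hm' : (m : ℝ) ≠ 0 := by exact_mod_cast hm.ne'
  have hkn : (k : ℝ) = m * n := by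
    field_simp at hn
    linarith
  have hkn' : k = m * n := by exact_mod_cast hkn
  exact Int.eq_zero_of_abs_lt_dvd ⟨n, hkn'⟩ hk

variable {Λ : Type*} {t : ℕ}

lemma coe_circle_prod (f : Fin t → Λ) (w : Λ → Circle) :
    ((∏ a, w (f a) : Circle) : ℂ) = ∏ a, (w (f a) : ℂ) :=
  map_prod Circle.coeHom _ _

lemma prod_exp_zpow [Fintype Λ] (k : Λ → ℤ) (θ : Λ → ℝ) :
    ∏ μ, Circle.exp (θ μ) ^ k μ = Circle.exp (∑ μ, k μ * θ μ) := by
  rw [circle_exp_sum]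
  exact Finset.prod_congr rfl fun μ _ => (Circle.exp_intCast_mul _ _).symm

variable [DecidableEq Λ]

/-- The weight of the torus `Λ → Circle` on the tensor component
`p (f 1) ⊗ ⋯ ⊗ p (f t) ⊗ p (g 1)* ⊗ ⋯ ⊗ p (g t)*`. -/
def weight (f g : Fin t → Λ) (μ : Λ) : ℤ :=
  ((Finset.univ.filter fun a => f a = μ).card : ℤ) - (Finset.univ.filter fun a => g a = μ).card

lemma abs_weight_le (f g : Fin t → Λ) (μ : Λ) : |weight f g μ| ≤ t := by
  have h : ∀ f : Fin t → Λ, (Finset.univ.filter fun a => f a = μ).card ≤ t := fun f => by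
    simpa using Finset.card_le_univ (Finset.univ.filter fun a => f a = μ)
  have h1 := h f
  have h2 := h g
  rw [weight, abs_le]
  omega

variable [Fintype Λ]

lemma prod_comp_eq_prod_pow (f : Fin t → Λ) (w : Λ → Circle) :
    ∏ a, w (f a) = ∏ μ, w μ ^ (Finset.univ.filter fun a => f a = μ).card := by
  rw [← Finset.prod_fiberwise Finset.univ f]
  refine Finset.prod_congr rfl fun μ _ => ?_
  rw [Finset.prod_congr rfl fun a ha => by rw [(Finset.mem_filter.mp ha).2], Finset.prod_const]

lemma prod_zpow_weight (f g : Fin t → Λ) (w : Λ → Circle) :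
    ∏ μ, w μ ^ weight f g μ = (∏ a, w (f a)) * (∏ a, w (g a))⁻¹ := by
  rw [prod_comp_eq_prod_pow, prod_comp_eq_prod_pow, ← Finset.prod_inv_distrib,
    ← Finset.prod_mul_distrib]
  refine Finset.prod_congr rfl fun μ _ => ?_
  rw [weight, zpow_sub, zpow_natCast, zpow_natCast]

end

/-! ### The design property -/

section

variable {ℋ : Type*} [NormedAddCommGroup ℋ] [InnerProductSpace ℂ ℋ] [CompleteSpace ℋ]
  {κ : Type*} [Fintype κ] [DecidableEq κ] (b : OrthonormalBasis κ ℂ ℋ) {t : ℕ}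
  {Λ : Type*} [Fintype Λ] [DecidableEq Λ] {p : Λ → ℋ →L[ℂ] ℋ}

lemma IsResolution.mixedTensor_mul_diagHom (hp : IsResolution p) (f g : Fin t → Λ)
    (w : Λ → Circle) :
    mixedTensor b (fun a => p (f a)) (fun a => p (g a))
        * tensorRep b t (hp.diagHom w : ℋ →L[ℂ] ℋ)
      = ((∏ μ, w μ ^ weight f g μ : Circle) : ℂ)
        • mixedTensor b (fun a => p (f a)) (fun a => p (g a)) := by
  have h : ∀ f : Fin t → Λ, (fun a => p (f a)) * (fun _ => (hp.diagHom w : ℋ →L[ℂ] ℋ))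
      = fun a => (w (f a) : ℂ) • p (f a) := fun f =>
    funext fun a => hp.proj_mul_diagOp _ _
  rw [tensorRep, mixedTensor_mul, h, h, mixedTensor_smul, prod_zpow_weight]
  congr 1
  rw [Circle.coe_mul, Circle.coe_inv_eq_conj, coe_circle_prod, coe_circle_prod, map_prod]
  rfl

/-- If every weight that occurs in `M` is trivial, then the torus fixes `M`. -/
lemma IsResolution.tensorRep_diagHom_mul (hp : IsResolution p)
    {M : Matrix ((Fin t → κ) × (Fin t → κ)) ((Fin t → κ) × (Fin t → κ)) ℂ}
    (h : ∀ f g : Fin t → Λ,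
      mixedTensor b (fun a => p (f a)) (fun a => p (g a)) * M ≠ 0 → ∀ μ, weight f g μ = 0)
    (w : Λ → Circle) : tensorRep b t (hp.diagHom w : ℋ →L[ℂ] ℋ) * M = M := by
  have hsum : ∀ T, T = ∑ f : Fin t → Λ, ∑ g : Fin t → Λ,
      mixedTensor b (fun a => p (f a)) (fun a => p (g a)) * T := fun T => by
    simp_rw [← Finset.sum_mul]
    rw [sum_mixedTensor b hp.complete, one_mul]
  rw [hsum (tensorRep b t _ * M)]
  conv_rhs => rw [hsum M]
  refine Finset.sum_congr rfl fun f _ => Finset.sum_congr rfl fun g _ => ?_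
  rw [← Matrix.mul_assoc, hp.mixedTensor_mul_diagHom, Matrix.smul_mul]
  by_cases h0 : mixedTensor b (fun a => p (f a)) (fun a => p (g a)) * M = 0
  · rw [h0]
    exact smul_zero _
  · have h1 : ∏ μ, w μ ^ weight f g μ = 1 :=
      Finset.prod_eq_one fun μ _ => by rw [h f g h0, zpow_zero]
    rw [h1, Circle.coe_one, one_smul]

/-- A torus element fixing `M` acts trivially through each weight that occurs in `M`. -/
lemma IsResolution.prod_zpow_weight_eq_one (hp : IsResolution p)
    {M : Matrix ((Fin t → κ) × (Fin t → κ)) ((Fin t → κ) × (Fin t → κ)) ℂ}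
    {f g : Fin t → Λ} (h0 : mixedTensor b (fun a => p (f a)) (fun a => p (g a)) * M ≠ 0)
    {w : Λ → Circle} (hw : tensorRep b t (hp.diagHom w : ℋ →L[ℂ] ℋ) * M = M) :
    ∏ μ, w μ ^ weight f g μ = 1 := by
  have h := congrArg (mixedTensor b (fun a => p (f a)) (fun a => p (g a)) * ·) hw
  simp only [← Matrix.mul_assoc] at h
  rw [hp.mixedTensor_mul_diagHom, Matrix.smul_mul] at h
  exact Circle.ext (smul_left_injective ℂ h0 (h.trans (one_smul ℂ _).symm))

variable [FiniteDimensional ℂ ℋ] {G : Type*} [Group G] {U : G →* UGroup ℋ} {ι : Type*}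
  {H : ι → ℋ →L[ℂ] ℋ} {W : Subgroup (UGroup ℋ)} {Δ : Finset (Irreps U)}

/-- The central torus part of a one-parameter group of `W` belongs to `W`. -/
lemma central_exp_mem (hH : ∀ l, IsInvariantHamiltonian U (H l)) (hgen : W = generatedGroup H)
    (hsemi : IsSemiUniversal U W) (l : ι) (s : ℝ) :
    isResolution_proj.diagHom (fun μ : Irreps U =>
      Circle.exp (s * ((tr (H l * proj U μ)).re / (tr (proj U μ)).re))) ∈ W := by
  obtain ⟨V, hV, r, hr, hVr⟩ := exists_exp_eq_central_mul (hH l) s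
  have hVW : V ∈ W := by
    rw [hgen]
    exact Subgroup.subset_closure ⟨l, s, hV⟩
  rw [eq_mul_inv_of_mul_eq hVr.symm]
  exact mul_mem hVW (inv_mem (hsemi.1 hr))

/-- If `t` is smaller than every multiplicity outside `Δ` and the phases on `Δ` are free, then every
weight of the central torus that occurs in the `t`-th moment of `W` vanishes, so that the moment is
fixed by all symmetric unitaries. -/
theorem isDesign_of_lt_mult [CompactSpace W] (hH : ∀ l, IsInvariantHamiltonian U (H l))
    (hgen : W = generatedGroup H) (hsemi : IsSemiUniversal U W) (hΔ : PhasesFree U H Δ)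
    (ht : ∀ μ ∉ Δ, t < mult U μ) : IsDesign b U (uniformMeasure W) t := by
  classical
  refine moment_eq_of_forall b hsemi.2 fun V hV => ?_
  set M := moment b (uniformMeasure W) t
  have hW : ∀ V ∈ W, tensorRep b t (V : ℋ →L[ℂ] ℋ) * M = M := fun V hV =>
    tensorRep_mul_moment b W hV
  obtain ⟨w, s, hs, rfl⟩ := exists_eq_central_mul hV
  rw [Submonoid.coe_mul, tensorRep_mul, Matrix.mul_assoc, hW s (hsemi.1 hs)]
  refine isResolution_proj.tensorRep_diagHom_mul b (fun f g hfg => ?_) w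
  -- outside `Δ`, a nonzero weight would have to be a multiple of a number exceeding `t`
  have hout : ∀ μ ∉ Δ, weight f g μ = 0 := by
    intro μ hμ
    obtain ⟨m, hm, hm0, hmem⟩ := exists_central_rootOfUnity_mem μ
    have h := isResolution_proj.prod_zpow_weight_eq_one b hfg (hW _ (hsemi.1 hmem))
    rw [Finset.prod_eq_single μ (fun ν _ hν => by rw [Pi.mulSingle_eq_of_ne hν, one_zpow])
      (by simp), Pi.mulSingle_eq_same] at h
    refine eq_zero_of_exp_two_pi_div_zpow hm0 ((abs_weight_le f g μ).trans_lt ?_) h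
    exact_mod_cast (ht μ hμ).trans_le hm
  -- on `Δ`, the weights are orthogonal to the phases of every generator
  have horth : ∀ l, ∑ μ, (weight f g μ : ℝ)
      * ((tr (H l * proj U μ)).re / (tr (proj U μ)).re) = 0 := by
    intro l
    refine eq_zero_of_forall_exp_mul_eq_one fun s => ?_
    have h := isResolution_proj.prod_zpow_weight_eq_one b hfg
      (hW _ (central_exp_mem hH hgen hsemi l s))
    rw [prod_exp_zpow] at h
    rw [← h, Finset.mul_sum]
    congr 1
    exact Finset.sum_congr rfl fun μ _ => by ring
  have hy := phasesFree_iff.mp hΔ (fun μ => weight f g μ.1 / (tr (proj U μ.1)).re) fun l => by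
    rw [← horth l, ← Finset.sum_subset (Finset.subset_univ Δ) fun μ _ hμ => by
      rw [hout μ hμ, Int.cast_zero, zero_mul], ← Finset.sum_coe_sort Δ, dotProduct]
    refine Finset.sum_congr rfl fun μ _ => ?_
    rw [chiVec]
    ring
  intro μ
  by_cases hμ : μ ∈ Δ
  · have h := (div_eq_zero_iff.mp (congrFun hy ⟨μ, hμ⟩)).resolve_right (tr_proj_re_pos μ).ne'
    exact_mod_cast h
  · exact hout μ hμ

end

end SymDesign

theorem mainTheorem2
    {G : Type*} [Group G] [TopologicalSpace G] [IsTopologicalGroup G] [CompactSpace G]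
    {ℋ : Type*} [NormedAddCommGroup ℋ] [InnerProductSpace ℂ ℋ] [CompleteSpace ℋ]
    [FiniteDimensional ℂ ℋ]
    {κ : Type*} [Fintype κ] [DecidableEq κ] (b : OrthonormalBasis κ ℂ ℋ)
    (U : G →* SymDesign.UGroup ℋ) (hU : Continuous U)
    {ι : Type*} (H : ι → ℋ →L[ℂ] ℋ) (hH : ∀ l, SymDesign.IsInvariantHamiltonian U (H l))
    (W : Subgroup (SymDesign.UGroup ℋ)) [CompactSpace W]
    (hgen : W = SymDesign.generatedGroup H) (hsemi : SymDesign.IsSemiUniversal U W)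
    (Δ : Finset (SymDesign.Irreps U)) :
    (SymDesign.PhasesFree U H Δ ↔ (SymDesign.phaseMatrix U H Δ).rank = Δ.card) ∧
    (SymDesign.PhasesFree U H Δ →
      SymDesign.tMax b U W ≥ (⨅ μ : {μ : SymDesign.Irreps U // μ ∉ Δ},
        (SymDesign.mult U μ.1 : ℕ∞)) - 1) := by
  refine ⟨SymDesign.phasesFree_iff_rank, fun hΔ => ?_⟩
  refine ENat.forall_natCast_le_iff_le.mp fun t ht => ?_
  refine le_sSup ⟨t, SymDesign.isDesign_of_lt_mult b hH hgen hsemi hΔ fun μ hμ => ?_, rfl⟩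
  have h1 : (t : ℕ∞) ≤ (SymDesign.mult U μ : ℕ∞) - 1 :=
    ht.trans (tsub_le_tsub_right (iInf_le (fun μ : {μ : SymDesign.Irreps U // μ ∉ Δ} =>
      (SymDesign.mult U μ.1 : ℕ∞)) ⟨μ, hμ⟩) 1)
  have h2 : t ≤ SymDesign.mult U μ - 1 := by exact_mod_cast h1
  have h3 := SymDesign.mult_pos μ
  omega
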